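/- Let $E$ be a finite-dimensional real vector space with a negative definite scalar product $\langle\cdot,\cdot\rangle$ and $\dim E = n-1\equiv 4 \pmod 8$. Let $b$ be a non-degenerate symmetric bilinear form on $E$, and define $B\in\mathrm{End}_{\mathbb R}(E)$ by $b(x,y)=-\langle Bx,y\rangle$. For $x\in E$ put $x^\flat=\langle x,\cdot\rangle\in E^*$. Let $\mathfrak{heis}_b=E^*+E+\mathbb{R}p$ be the Lie algebra whose only non-trivial brackets are $[x^\flat,y]=b(x,y)\,p$ for $x,y\in E$. Let $\mathrm{Cl}(E)$ be the Clifford algebra with relation $v^2=-\langle v,v\rangle$, let $S_0$ be an irreducible real $\mathrm{Cl}(E)$-module, and let $\omega=e_1\cdots e_{n-1}$ be the volume form of an orthonormal basis of $E$ (i.e. $\langle e_i,e_j\rangle=-\delta_{ij}$). Let $\mathcal C^\circ$ be the even Schur algebra, the algebra of real endomorphisms of $S_0$ commuting with Clifford multiplication. Let $\mathfrak m=E\oplus\mathbb Rp\oplus\mathbb Rq$ be the Minkowski space extending $E$, with $\langle p,E\rangle=\langle q,E\rangle=\langle p,p\rangle=\langle q,q\rangle=0$ and $\langle p,q\rangle=1$.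 Let $S=S_-\oplus S_+$ with $S_\pm= S_0$ be its spin module, on which $x+sp+tq$ (with $x\in E$ and $s,t\in\mathbb R$) acts by $\begin{pmatrix}-x&2\sqrt2\,s\\-t/\sqrt2&x\end{pmatrix}$. A *spin representation* of $\mathfrak{heis}_b$ is a Lie algebra representation $\rho:\mathfrak{heis}_b\to\mathfrak{gl}_{\mathbb R}(S)$ such that $\rho(x^\flat)$ is the action of $p\wedge Bx=\tfrac14[p,Bx]\in\mathrm{Cl}(\mathfrak m)$ for all $x\in E$, that is, $\rho(x^\flat)=\begin{pmatrix}0&\sqrt2\,Bx\\0&0\end{pmatrix}$. It has *non-zero charge* if $\rho(p)\neq0$. For $\rho_{11},\rho_{22},\rho_{12}\in\mathrm{Hom}_{\mathbb R}(E,\mathrm{End}_{\mathbb R}(S_0))$, the map $\rho_{12}$ is called $(\rho_{11},\rho_{22})$-*suitable* if $\rho_{11}(x)\rho_{12}(y)-\rho_{12}(y)\rho_{22}(x)$ is symmetric in $x,y\in E$. **Theorem.** The even Schur algebra $\mathcal C^\circ$ is isomorphic to $\mathbb H$ as a real algebra. Fix any isomorphism $\mathcal C^\circ\cong\mathbb H$.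 The spin representations of $\mathfrak{heis}_b$ of non-zero charge are exactly the linear maps $\rho$ given by $\rho(x^\flat)=\begin{pmatrix}0&\sqrt2\,Bx\\0&0\end{pmatrix}$ and $$\rho(p)=\sqrt2\begin{pmatrix}0&h_1(\mathrm{Id}\pm\omega)\\0&0\end{pmatrix},\qquad \rho(x)=\begin{pmatrix}\rho_{11}(x)&\rho_{12}(x)\\0&\rho_{22}(x)\end{pmatrix}\quad(x\in E),$$ $$2\rho_{11}(x)=h_3(x)\,\mathrm{Id}-h_1x\pm h_1x\,\omega-h_4(x)\,\omega,\qquad 2\rho_{22}(x)=h_3(x)\,\mathrm{Id}+h_1x\pm h_1x\,\omega+h_4(x)\,\omega,$$ where the sign $\pm$ is the same throughout, $h_1\in\mathbb H$, $h_3,h_4\in\mathrm{Hom}_{\mathbb R}(E,\mathbb H)$, the map $\rho_{12}\in\mathrm{Hom}_{\mathbb R}(E,\mathrm{End}_{\mathbb R}(S_0))$ is $(\rho_{11},\rho_{22})$-suitable, and one of the following holds: 1. $\operatorname{Re}h_1\ne0$, the linear map $\operatorname{Im}h_3:E\to\operatorname{Im}\mathbb H$ satisfies $\dim\bigl(E/\operatorname{Ker}(\operatorname{Im}h_3)\bigr)\le1$,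 and $h_4(x)=\mp\dfrac{\operatorname{Im}h_1\times\operatorname{Im}h_3(x)}{\operatorname{Re}h_1}$ for all $x\in E$ (upper sign for $+$, lower sign for $-$); 2. $\operatorname{Re}h_1=0$, $\operatorname{Im}h_1\neq0$, and there are linear forms $h_3^{\mathbb R},h_3^{\mathbb C},\mu:E\to\mathbb R$ and a unit imaginary quaternion $\nu\perp\operatorname{Im}h_1$ with $h_3(x)=h_3^{\mathbb R}(x)+h_3^{\mathbb C}(x)\frac{\operatorname{Im}h_1}{|\operatorname{Im}h_1|}$ and $h_4(x)=\mu(x)\,\nu$ for all $x\in E$, where $\operatorname{Ker}\mu=\operatorname{Ker}h_3^{\mathbb C}$ if $h_3^{\mathbb C}\ne0$ and $\mu\neq0$. -/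

import Mathlib

open scoped Quaternion

namespace CahenWallach

noncomputable section

section Euclidean

variable (E : Type*) [NormedAddCommGroup E] [InnerProductSpace ℝ E]

/-- The restriction to `E` of the Lorentzian scalar product of signature `(+, -)`. It is negative
definite, i.e. minus the Euclidean inner product of `E`. -/
def metric : LinearMap.BilinForm ℝ E := -(innerₗ E)

/-- The quadratic form `v ↦ -⟨v, v⟩`, so that the Clifford relation is `v * v = -⟨v, v⟩`. -/
def cliffordForm : QuadraticForm ℝ E := -(metric E).toQuadraticMap

/-- The Clifford algebra of `E = ℝ^{0, n - 1}`, with relation `v * v + ⟨v, v⟩ = 0`. -/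
abbrev Cl : Type _ := CliffordAlgebra (cliffordForm E)

/-- The Minkowski scalar product on `𝔪 = E ⊕ ℝ p ⊕ ℝ q`; the triple `(x, s, t)` stands for
`x + s p + t q`, where `p`, `q` are null, orthogonal to `E`, and `⟨p, q⟩ = 1`. -/
def minkowski : LinearMap.BilinForm ℝ (E × ℝ × ℝ) :=
  LinearMap.mk₂ ℝ (fun v w => metric E v.1 w.1 + (v.2.1 * w.2.2 + v.2.2 * w.2.1))
    (by intros; simp; ring) (by intros; simp; ring) (by intros; simp; ring)
    (by intros; simp; ring)

/-- The quadratic form `v ↦ -⟨v, v⟩` on the Minkowski space. -/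
def minkowskiForm : QuadraticForm ℝ (E × ℝ × ℝ) := -(minkowski E).toQuadraticMap

variable {E}

lemma cliffordForm_apply (x : E) : cliffordForm E x = inner ℝ x x := by
  simp [cliffordForm, metric, innerₗ_apply_apply]

lemma minkowskiForm_apply (v : E × ℝ × ℝ) :
    minkowskiForm E v = inner ℝ v.1 v.1 - 2 * (v.2.1 * v.2.2) := by
  simp [minkowskiForm, minkowski, metric, innerₗ_apply_apply]
  ring

/-- The element `v ∧ w` of `𝔰𝔬(𝔪)`, embedded in the Clifford algebra of `𝔪` as `[v, w] / 4`. -/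
def wedge (v w : E × ℝ × ℝ) : CliffordAlgebra (minkowskiForm E) :=
  (1 / 4 : ℝ) •
    ⁅CliffordAlgebra.ι (minkowskiForm E) v, CliffordAlgebra.ι (minkowskiForm E) w⁆

/-- The volume form `e₁ ⋯ e_m` of an orthonormal basis. -/
def volumeForm {m : ℕ} (e : OrthonormalBasis (Fin m) ℝ E) : Cl E :=
  (List.ofFn fun i => CliffordAlgebra.ι (cliffordForm E) (e i)).prod

variable (E) in
lemma metric_nondegenerate : (metric E).Nondegenerate := by
  constructor <;>
  · intro x hx
    have h := hx x
    simpa [metric, innerₗ_apply_apply] using h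

section Musical

variable [FiniteDimensional ℝ E]

variable (E) in
/-- The musical isomorphism `e ↦ e^♭ = ⟨e, ·⟩`. -/
def flat : E ≃ₗ[ℝ] Module.Dual ℝ E := (metric E).toDual (metric_nondegenerate E)

lemma flat_apply (x y : E) : flat E x y = metric E x y := rfl

/-- The endomorphism `B` of `E` with `b(x, y) = -⟨B x, y⟩`. -/
def endB (b : LinearMap.BilinForm ℝ E) : E →ₗ[ℝ] E := -((flat E).symm.toLinearMap ∘ₗ b)

lemma endB_spec (b : LinearMap.BilinForm ℝ E) (x y : E) : b x y = -metric E (endB b x) y := by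
  have h : flat E ((flat E).symm (b x)) y = b x y := by simp
  rw [flat_apply] at h
  simp [endB, h]

end Musical

/-! ### The Heisenberg algebra -/

/-- The vector space `𝔥𝔢𝔦𝔰_b = E^* + E + ℝ p`. -/
def Heis (_b : LinearMap.BilinForm ℝ E) : Type _ := Module.Dual ℝ E × E × ℝ

namespace Heis

variable (b : LinearMap.BilinForm ℝ E)

instance : AddCommGroup (Heis b) := inferInstanceAs (AddCommGroup (Module.Dual ℝ E × E × ℝ))

instance : Module ℝ (Heis b) := inferInstanceAs (Module ℝ (Module.Dual ℝ E × E × ℝ))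

/-- The inclusion of `E^*`. -/
def ofDual : Module.Dual ℝ E →ₗ[ℝ] Heis b := LinearMap.inl ℝ (Module.Dual ℝ E) (E × ℝ)

/-- The inclusion of `E`. -/
def ofVec : E →ₗ[ℝ] Heis b :=
  LinearMap.inr ℝ (Module.Dual ℝ E) (E × ℝ) ∘ₗ LinearMap.inl ℝ E ℝ

/-- The central element `p`. -/
def p : Heis b := ((0, 0, 1) : Module.Dual ℝ E × E × ℝ)

/-- The component in `E^*`. -/
def dualPart : Heis b →ₗ[ℝ] Module.Dual ℝ E := LinearMap.fst ℝ (Module.Dual ℝ E) (E × ℝ)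

/-- The component in `E`. -/
def vecPart : Heis b →ₗ[ℝ] E :=
  LinearMap.fst ℝ E ℝ ∘ₗ LinearMap.snd ℝ (Module.Dual ℝ E) (E × ℝ)

lemma dualPart_p : dualPart b (p b) = 0 := rfl

lemma vecPart_p : vecPart b (p b) = 0 := rfl

variable [FiniteDimensional ℝ E]

/-- The brackets of the Heisenberg algebra: `[e^♭, f] = b(e, f) p`, where `E^*` and `E` are
abelian and `p` is central. -/
instance : Bracket (Heis b) (Heis b) where
  bracket u v := (b ((flat E).symm (dualPart b u)) (vecPart b v)
    - b ((flat E).symm (dualPart b v)) (vecPart b u)) • p b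

lemma bracket_def (u v : Heis b) :
    ⁅u, v⁆ = (b ((flat E).symm (dualPart b u)) (vecPart b v)
      - b ((flat E).symm (dualPart b v)) (vecPart b u)) • p b := rfl

instance : LieRing (Heis b) where
  add_lie u v w := by
    simp only [bracket_def, map_add, LinearMap.add_apply]
    module
  lie_add u v w := by
    simp only [bracket_def, map_add, LinearMap.add_apply]
    module
  lie_self u := by simp [bracket_def]
  leibniz_lie u v w := by simp [bracket_def, dualPart_p, vecPart_p]

instance : LieAlgebra ℝ (Heis b) where
  lie_smul c u v := by
    simp only [bracket_def, map_smul, LinearMap.smul_apply, smul_eq_mul]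
    module

lemma flat_lie_vec (x y : E) : ⁅ofDual b (flat E x), ofVec b y⁆ = b x y • p b := by
  have h1 : dualPart b (ofDual b (flat E x)) = flat E x := rfl
  have h2 : vecPart b (ofDual b (flat E x)) = 0 := rfl
  have h3 : dualPart b (ofVec b y) = 0 := rfl
  have h4 : vecPart b (ofVec b y) = y := rfl
  simp [bracket_def, h1, h2, h3, h4]

end Heis

end Euclidean

section Spinors

variable {E : Type*} [NormedAddCommGroup E] [InnerProductSpace ℝ E]
variable (S : Type*) [AddCommGroup S] [Module ℝ S] [Module (Cl E) S] [IsScalarTower ℝ (Cl E) S]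

/-- The action of the Clifford algebra of `E` on a module `S`. -/
def act : Cl E →ₐ[ℝ] Module.End ℝ S := Algebra.lsmul ℝ ℝ S

/-- Clifford multiplication by vectors of `E` on `S`. -/
def cmul : E →ₗ[ℝ] Module.End ℝ S :=
  (act S).toLinearMap ∘ₗ CliffordAlgebra.ι (cliffordForm E)

lemma cmul_cmul (x : E) (s : S) : cmul S x (cmul S x s) = (inner ℝ x x : ℝ) • s := by
  have h : cmul S x * cmul S x = algebraMap ℝ (Module.End ℝ S) (inner ℝ x x) := by
    have := congrArg (act S) (CliffordAlgebra.ι_sq_scalar (cliffordForm E) x)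
    rw [map_mul, cliffordForm_apply] at this
    simpa [cmul] using this
  exact congrArg (fun f : Module.End ℝ S => f s) h

variable (E) in
/-- The even Schur algebra: the real algebra of the endomorphisms of `S` that commute with Clifford
multiplication by vectors (hence with `𝔰𝔬(E)` and with the whole Clifford algebra). -/
def evenSchur : Subalgebra ℝ (Module.End ℝ S) :=
  Subalgebra.centralizer ℝ (Set.range (cmul S : E →ₗ[ℝ] Module.End ℝ S))

variable {S}

/-- The endomorphism of `S_- ⊕ S_+ = S ⊕ S` with block matrix `(a, b; c, d)`. -/
def block (a b c d : Module.End ℝ S) : Module.End ℝ (S × S) :=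
  (a.coprod b).prod (c.coprod d)

lemma block_apply (a b c d : Module.End ℝ S) (s : S × S) :
    block a b c d s = (a s.1 + b s.2, c s.1 + d s.2) := rfl

variable (S)

/-- The action of the vectors of the Minkowski space on `S_- ⊕ S_+`: the vector `x + s p + t q`
acts by the block matrix `(-x, 2 √2 s; -t / √2, x)`. -/
def vecAct : E × ℝ × ℝ →ₗ[ℝ] Module.End ℝ (S × S) where
  toFun v := block (-cmul S v.1) ((2 * √2 * v.2.1) • 1) ((-(1 / √2) * v.2.2) • 1) (cmul S v.1)
  map_add' v w := by
    ext s <;> simp [block, mul_add, add_smul]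
    abel
  map_smul' c v := by
    ext s <;> simp [block, smul_smul] <;> congr 1 <;> ring

lemma vecAct_apply (v : E × ℝ × ℝ) (s : S × S) :
    vecAct S v s = (-cmul S v.1 s.1 + (2 * √2 * v.2.1) • s.2,
      (-(1 / √2) * v.2.2) • s.1 + cmul S v.1 s.2) := rfl

/-- The spin representation of the Clifford algebra of the Minkowski space `𝔪`, on the spin module
`S_- ⊕ S_+` obtained from the `Cl(E)`-module `S`. -/
def spinRep : CliffordAlgebra (minkowskiForm E) →ₐ[ℝ] Module.End ℝ (S × S) :=
  CliffordAlgebra.lift (minkowskiForm E) ⟨vecAct S, fun v => by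
    have h2 : √2 ≠ 0 := by positivity
    refine LinearMap.ext fun s => ?_
    rw [minkowskiForm_apply, Module.algebraMap_end_apply, Module.End.mul_apply]
    simp only [vecAct_apply, map_add, map_neg, map_smul, cmul_cmul, Prod.smul_def]
    refine Prod.ext ?_ ?_ <;>
    · dsimp only
      match_scalars <;> field_simp <;> ring⟩

variable {S}

variable [FiniteDimensional ℝ E]

/-- A linear map `ρ : 𝔥𝔢𝔦𝔰_b → 𝔤𝔩(S_- ⊕ S_+)` is a spin representation if it is a representation
of the Lie algebra `𝔥𝔢𝔦𝔰_b` whose restriction to `E^*` is the spin representation composed with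
the isotropy embedding `e^♭ ↦ p ∧ B e` into `𝔰𝔬(𝔪)`. -/
structure IsSpinRepresentation (b : LinearMap.BilinForm ℝ E)
    (ρ : Heis b →ₗ[ℝ] Module.End ℝ (S × S)) : Prop where
  map_lie : ∀ u v : Heis b, ρ ⁅u, v⁆ = ⁅ρ u, ρ v⁆
  spin : ∀ x : E, ρ (Heis.ofDual b (flat E x)) =
    spinRep (E := E) S (wedge ((0, 1, 0) : E × ℝ × ℝ) (endB b x, 0, 0))

/-! ### The data of a representation of non-zero charge -/

/-- The linear map `h ↦ Im h` on the quaternions. -/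
def imₗ : ℍ[ℝ] →ₗ[ℝ] ℍ[ℝ] where
  toFun h := h.im
  map_add' _ _ := by simp
  map_smul' _ _ := by simp

/-- The cross product of (imaginary parts of) quaternions, for the identification of the imaginary
quaternions with `ℝ³` by the basis `i, j, k`. -/
def cross (u v : ℍ[ℝ]) : ℍ[ℝ] :=
  ⟨0, u.imJ * v.imK - u.imK * v.imJ, u.imK * v.imI - u.imI * v.imK,
    u.imI * v.imJ - u.imJ * v.imI⟩

/-- A map `ρ₁₂` is `(ρ₁₁, ρ₂₂)`-suitable if `ρ₁₁(x) ρ₁₂(y) - ρ₁₂(y) ρ₂₂(x)` is symmetric in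
`x` and `y`. -/
def IsSuitable (ρ₁₁ ρ₂₂ ρ₁₂ : E →ₗ[ℝ] Module.End ℝ S) : Prop :=
  ∀ x y : E, ρ₁₁ x * ρ₁₂ y - ρ₁₂ y * ρ₂₂ x = ρ₁₁ y * ρ₁₂ x - ρ₁₂ x * ρ₂₂ y

/-- The endomorphism of `S` that corresponds to a quaternion under an identification of the
quaternions with the even Schur algebra. -/
def quat (φ : ℍ[ℝ] ≃ₐ[ℝ] evenSchur E S) : ℍ[ℝ] →ₐ[ℝ] Module.End ℝ S :=
  (evenSchur E S).val.comp φ.toAlgHom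

/-- `ρ₁₁(x) = (h₃(x) - h₁ x + ε h₁ x ω - h₄(x) ω) / 2`. -/
def rho₁₁ (φ : ℍ[ℝ] ≃ₐ[ℝ] evenSchur E S) (ω : Module.End ℝ S) (ε : ℝ) (h₁ : ℍ[ℝ])
    (h₃ h₄ : E →ₗ[ℝ] ℍ[ℝ]) : E →ₗ[ℝ] Module.End ℝ S where
  toFun x := (1 / 2 : ℝ) • (quat φ (h₃ x) - quat φ h₁ * cmul S x
    + ε • (quat φ h₁ * cmul S x * ω) - quat φ (h₄ x) * ω)
  map_add' x y := by
    simp only [map_add, mul_add, add_mul]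
    module
  map_smul' c x := by
    simp only [map_smul, mul_smul_comm, smul_mul_assoc, RingHom.id_apply]
    module

/-- `ρ₂₂(x) = (h₃(x) + h₁ x + ε h₁ x ω + h₄(x) ω) / 2`. -/
def rho₂₂ (φ : ℍ[ℝ] ≃ₐ[ℝ] evenSchur E S) (ω : Module.End ℝ S) (ε : ℝ) (h₁ : ℍ[ℝ])
    (h₃ h₄ : E →ₗ[ℝ] ℍ[ℝ]) : E →ₗ[ℝ] Module.End ℝ S where
  toFun x := (1 / 2 : ℝ) • (quat φ (h₃ x) + quat φ h₁ * cmul S x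
    + ε • (quat φ h₁ * cmul S x * ω) + quat φ (h₄ x) * ω)
  map_add' x y := by
    simp only [map_add, mul_add, add_mul]
    module
  map_smul' c x := by
    simp only [map_smul, mul_smul_comm, smul_mul_assoc, RingHom.id_apply]
    module

/-- First case: `Re h₁ ≠ 0`, the map `Im h₃` has rank at most one, and
`h₄(x) = -ε (Im h₁ × Im h₃(x)) / Re h₁`. -/
def FirstCase (ε : ℝ) (h₁ : ℍ[ℝ]) (h₃ h₄ : E →ₗ[ℝ] ℍ[ℝ]) : Prop :=
  h₁.re ≠ 0 ∧ Module.finrank ℝ (LinearMap.range (imₗ ∘ₗ h₃)) ≤ 1 ∧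
    ∀ x, h₄ x = -(ε / h₁.re) • cross h₁.im (h₃ x).im

/-- Second case: `Re h₁ = 0`, `Im h₁ ≠ 0`, the map `h₃ = r + c (Im h₁ / |Im h₁|)` takes values in
the copy `ℝ ⊕ ℝ (Im h₁ / |Im h₁|)` of the complex numbers, the map `h₄ = μ ν` takes values in the
real line spanned by an imaginary unit `ν` orthogonal to `Im h₁`, and `μ`, `c` have the same kernel
if neither of them vanishes. -/
def SecondCase (h₁ : ℍ[ℝ]) (h₃ h₄ : E →ₗ[ℝ] ℍ[ℝ]) : Prop :=
  h₁.re = 0 ∧ h₁.im ≠ 0 ∧ ∃ (r c μ : E →ₗ[ℝ] ℝ) (ν : ℍ[ℝ]),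
    ν.re = 0 ∧ ‖ν‖ = 1 ∧ inner ℝ h₁.im ν = 0 ∧
    (∀ x, h₃ x = (r x : ℍ[ℝ]) + c x • (‖h₁.im‖⁻¹ • h₁.im)) ∧
    (∀ x, h₄ x = μ x • ν) ∧
    (c ≠ 0 → μ ≠ 0 → LinearMap.ker μ = LinearMap.ker c)

end Spinors

end

end CahenWallach

/-! Two arguments carry the theorem. The first is a Frobenius–Schur count that identifies the
commutant of Clifford multiplication. For a suitable inner product on `S`, an orthonormal basis of
`E` acts by `N = dim E` symmetric anticommuting involutions. Put `m = dim S` and `c = 2 ^ (N / 2)`.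
Averaging `X ↦ g X gᵀ` over the products `g` of basis vectors projects onto the commutant, and the
trace shows that its dimension is `m² / c²`. By the spectral theorem and Schur's lemma the symmetric
elements of the commutant are the scalars; the projection onto them has trace `(m² - c m) / (2 c²)`,
the minus sign being due to `N ≡ 4 (mod 8)`. Hence `m = 2 c` and the commutant has dimension 4
(`finrank_centralizer`). Two anticommuting skew elements of it generate `ℍ`.

The second argument solves the bracket relations. The bracket of `E^*` with `E` forces `ρ(y)` to be
block triangular, with diagonal `a y`, `d y`, and `ρ(p)` to be `√2 Q` in the upper corner
(`isSpinRepresentation_iff`). Besides suitability there remain `z d(y) - a(y) z = (z, y) Q` for the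
Euclidean product, `Q d(y) = a(y) Q`, and the commutation of the `a`'s and of the `d`'s. For a unit
vector `y`, the sum and the difference of `a y` and `d y` split under conjugation by `y` into four
parts with the commutation signs of `1`, `yω`, `y`, `ω`; each part is thus a quaternion times that
element (`exists_decomposition`), and `Q = h₁ + h₂ ω`.

Comparing coefficients in `Q d = a Q` gives `h₁² = h₂²` and `h₁ h₂ = h₂ h₁`, so `h₂ = ε h₁` with `ε
= ±1` because `ℍ` has no zero divisors, and also `[h₁, h₃] + ε {h₁, h₄} = 0`. The `a`'s then commute
exactly when the values of `h₃ + h₄` commute with each other and so do those of `h₃ - h₄`.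
Quaternions commute when their imaginary parts are parallel, so what is left is vector algebra in
`ℝ³`, with two cases according to whether `Re h₁` vanishes (`twistedCommute_and_imParallel_iff`). -/

namespace CahenWallach

/-! ### Products of anticommuting involutions and their signs -/

section Anticommuting

variable {ι A : Type*} [Ring A]

/-- A family of pairwise anticommuting square roots of `1`. -/
structure IsAnticommuting (e : ι → A) : Prop where
  sq : ∀ i, e i * e i = 1
  anti : ∀ i j, i ≠ j → e i * e j = -(e j * e i)

namespace IsAnticommuting

variable {e : ι → A}

lemma mul_prod_of_notMem (he : IsAnticommuting e) {i : ι} {L : List ι} (hi : i ∉ L) :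
    e i * (L.map e).prod = (-1) ^ L.length * ((L.map e).prod * e i) := by
  induction L with
  | nil => simp
  | cons a L ih =>
    simp only [List.mem_cons, not_or] at hi
    have h := ih hi.2
    rw [List.map_cons, List.prod_cons, ← mul_assoc, he.anti i a hi.1, neg_mul, mul_assoc, h,
      List.length_cons, pow_succ, mul_neg_one, neg_mul, mul_assoc, ← mul_assoc (e a),
      ((Commute.neg_one_left (e a)).pow_left L.length).eq.symm, mul_assoc]

lemma mul_prod_of_mem (he : IsAnticommuting e) {i : ι} {L : List ι} (hL : L.Nodup) (hi : i ∈ L) :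
    e i * (L.map e).prod = -((-1) ^ L.length * ((L.map e).prod * e i)) := by
  induction L with
  | nil => simp at hi
  | cons a L ih =>
    rw [List.nodup_cons] at hL
    rw [List.map_cons, List.prod_cons, List.length_cons, pow_succ, mul_neg_one, neg_mul, neg_neg]
    have hc : ∀ x : A, e a * ((-1) ^ L.length * x) = (-1) ^ L.length * (e a * x) := fun x => by
      rw [← mul_assoc, ← ((Commute.neg_one_left (e a)).pow_left L.length).eq, mul_assoc]
    by_cases h : i = a
    · subst h
      have hs : ((-1 : A) ^ L.length) * (-1) ^ L.length = 1 := by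
        rw [← pow_add]; exact Even.neg_one_pow ⟨_, rfl⟩
      conv_rhs => rw [mul_assoc (e i)]
      rw [← hc, ← he.mul_prod_of_notMem hL.1]
    · have hi' : i ∈ L := by simpa [h] using hi
      rw [← mul_assoc, he.anti i a h, neg_mul, mul_assoc, ih hL.2 hi', mul_neg, neg_neg, hc,
        mul_assoc]

/-- Moving the head past the later factors costs one sign per factor, and these numbers of signs add
up to a binomial coefficient. -/
lemma prod_mul_prod (he : IsAnticommuting e) {L : List ι} (hL : L.Nodup) :
    (L.map e).prod * (L.map e).prod = (-1) ^ (L.length.choose 2) := by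
  induction L with
  | nil => simp
  | cons a L ih =>
    rw [List.nodup_cons] at hL
    have h := he.mul_prod_of_notMem hL.1
    have hs : ((-1 : A) ^ L.length) * (-1) ^ L.length = 1 := by
      rw [← pow_add]; exact Even.neg_one_pow ⟨_, rfl⟩
    have h' : (L.map e).prod * e a = (-1) ^ L.length * (e a * (L.map e).prod) := by
      rw [h, ← mul_assoc, hs, one_mul]
    rw [List.map_cons, List.prod_cons, mul_assoc, ← mul_assoc _ (e a), h', List.length_cons,
      Nat.choose_succ_succ' L.length 1, Nat.choose_one_right, pow_add, ← ih hL.2, mul_assoc,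
      ← mul_assoc (e a), ← ((Commute.neg_one_left (e a)).pow_left L.length).eq, mul_assoc,
      ← mul_assoc (e a) (e a * _), ← mul_assoc (e a) (e a), he.sq, one_mul]

end IsAnticommuting

/-- The sum over the sublists of `l` of the sign `(-1) ^ choose (length + k) 2`. -/
def signSum {α : Type*} (l : List α) (k : ℕ) : ℝ :=
  (l.sublists'.map fun L => (-1 : ℝ) ^ ((L.length + k).choose 2)).sum

/-- The exponents `choose (m + 2) 2` and `choose m 2` differ by the odd number `2 m + 1`. -/
lemma signSum_add_two {α : Type*} (l : List α) (k : ℕ) : signSum l (k + 2) = -signSum l k := by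
  have : ∀ m : ℕ, (-1 : ℝ) ^ ((m + 2).choose 2) = -1 * (-1) ^ (m.choose 2) := fun m => by
    rw [Nat.choose_succ_succ' (m + 1) 1, Nat.choose_succ_succ' m 1]
    simp only [Nat.choose_one_right, pow_add, pow_one, Nat.reduceAdd]
    have hs : ((-1 : ℝ) ^ m) * (-1) ^ m = 1 := by
      rw [← pow_add]; exact Even.neg_one_pow ⟨_, rfl⟩
    linear_combination (-(-1 : ℝ) ^ (m.choose 2)) * hs
  simp only [signSum, ← add_assoc, this]
  rw [List.sum_map_mul_left, neg_one_mul]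

/-- A sublist either omits `a` or contains it and is longer by one; the shift `k` is there to make
this recursion close. -/
lemma signSum_cons {α : Type*} (a : α) (l : List α) (k : ℕ) :
    signSum (a :: l) k = signSum l k + signSum l (k + 1) := by
  rw [signSum, List.sublists'_cons, List.map_append, List.sum_append, List.map_map]
  simp [signSum, Function.comp_def, add_assoc, add_comm 1 k]

lemma signSum_of_length {α : Type*} (q : ℕ) : ∀ l : List α, l.length = 4 * q →
    signSum l 0 = (-4) ^ q ∧ signSum l 1 = (-4) ^ q := by
  induction q with
  | zero =>
    intro l hl
    have : l = [] := by simpa using hl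
    subst this
    simp [signSum]
  | succ q ih =>
    intro l hl
    match l, hl with
    | a :: b :: c :: d :: l, hl =>
      obtain ⟨h0, h1⟩ := ih l (by simp at hl; omega)
      have f2 : signSum l 2 = _ := signSum_add_two l 0
      have f3 : signSum l 3 = _ := signSum_add_two l 1
      have f4 : signSum l 4 = _ := signSum_add_two l 2
      have f5 : signSum l 5 = _ := signSum_add_two l 3
      -- With `fₖ = signSum l k`, four steps of the recursion give `f₀ + 4 f₁ + 6 f₂ + 4 f₃ + f₄`,
      -- which `fₖ₊₂ = -fₖ` collapses to `-4 f₀`; the same holds with all indices shifted by one.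
      simp only [signSum_cons, zero_add, Nat.reduceAdd, f5, f4, f3, f2, h0, h1]
      constructor <;> ring

end Anticommuting


/-! ### Averaging matrices over the products of the involutions, and traces of the averages -/

section Averaging

variable {ι n : Type*} [Fintype n] [DecidableEq n]

lemma trace_mulLeftRight (A B : Matrix n n ℝ) :
    LinearMap.trace ℝ (Matrix n n ℝ) (LinearMap.mulLeftRight ℝ (A, B)) = A.trace * B.trace := by
  rw [LinearMap.trace_eq_matrix_trace ℝ (Matrix.stdBasis ℝ n n), Matrix.trace]
  simp only [Matrix.diag_apply, LinearMap.toMatrix_apply,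
    LinearMap.mulLeftRight_apply]
  rw [Fintype.sum_prod_type, Matrix.trace, Matrix.trace, Finset.sum_mul_sum]
  refine Finset.sum_congr rfl fun i _ => Finset.sum_congr rfl fun j _ => ?_
  have : ∀ M : Matrix n n ℝ, (Matrix.stdBasis ℝ n n).repr M (i, j) = M i j := fun M => rfl
  simp [this, Matrix.stdBasis_eq_single, Matrix.mul_apply, Matrix.single_apply, ite_and]

/-- The diagonal coefficient of `X ↦ A Xᵀ B` at the matrix unit `(i, j)` is `A i j * B i j`. For `A
= g` and `B = gᵀ` the trace is that of `g * g`, as in the Frobenius–Schur indicator. -/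
lemma trace_mulLeftRight_transpose (A B : Matrix n n ℝ) :
    LinearMap.trace ℝ (Matrix n n ℝ) (LinearMap.mulLeftRight ℝ (A, B) ∘ₗ
      (Matrix.transposeLinearEquiv n n ℝ ℝ).toLinearMap) = (A * B.transpose).trace := by
  rw [LinearMap.trace_eq_matrix_trace ℝ (Matrix.stdBasis ℝ n n), Matrix.trace]
  simp only [Matrix.diag_apply, LinearMap.toMatrix_apply,
    LinearMap.mulLeftRight_apply, LinearMap.comp_apply]
  rw [Fintype.sum_prod_type, Matrix.trace]
  refine Finset.sum_congr rfl fun i _ => ?_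
  rw [Matrix.diag_apply, Matrix.mul_apply]
  refine Finset.sum_congr rfl fun j _ => ?_
  have : ∀ M : Matrix n n ℝ, (Matrix.stdBasis ℝ n n).repr M (i, j) = M i j := fun M => rfl
  simp [this, Matrix.stdBasis_eq_single, Matrix.mul_apply, Matrix.single_apply, ite_and]

/-- The sum of the maps `X ↦ g X gᵀ` over the products `g` of sublists of `l`. -/
def average (e : ι → Matrix n n ℝ) (l : List ι) : Matrix n n ℝ →ₗ[ℝ] Matrix n n ℝ :=
  (l.sublists'.map fun L =>
    LinearMap.mulLeftRight ℝ ((L.map e).prod, (L.map e).prod.transpose)).sum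

variable {e : ι → Matrix n n ℝ}

lemma average_apply (l : List ι) (X : Matrix n n ℝ) :
    average e l X =
      (l.sublists'.map fun L => (L.map e).prod * X * (L.map e).prod.transpose).sum := by
  rw [average, ← LinearMap.applyₗ_apply_apply (R := ℝ) X, map_list_sum, List.map_map]
  rfl

lemma average_nil (X : Matrix n n ℝ) : average e [] X = X := by simp [average]

lemma average_cons (hs : ∀ i, (e i).transpose = e i) (a : ι) (l : List ι) (X : Matrix n n ℝ) :
    average e (a :: l) X = average e l X + e a * average e l X * e a := by
  rw [average_apply, average_apply, List.sublists'_cons, List.map_append, List.sum_append,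
    List.map_map, ← List.sum_map_mul_left, ← List.sum_map_mul_right]
  simp [Function.comp_def, hs, mul_assoc]

lemma transpose_average (hs : ∀ i, (e i).transpose = e i) (l : List ι) (X : Matrix n n ℝ) :
    (average e l X).transpose = average e l X.transpose := by
  induction l with
  | nil => simp [average_nil]
  | cons a l ih => simp [average_cons hs, ih, hs, mul_assoc]

/-- Conjugation by `e a` exchanges the two summands of `average_cons`. Conjugation by another `e i`
respects each of them, as the two signs from passing the two factors `e a` cancel. -/
lemma commute_average (he : IsAnticommuting e) (hs : ∀ i, (e i).transpose = e i) (l : List ι)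
    (X : Matrix n n ℝ) {i : ι} (hi : i ∈ l) : e i * average e l X = average e l X * e i := by
  induction l with
  | nil => simp at hi
  | cons a l ih =>
    rw [average_cons hs]
    by_cases h : i = a
    · subst h
      simp only [mul_add, add_mul, mul_assoc, he.sq, mul_one]
      rw [← mul_assoc (e i) (e i), he.sq, one_mul, add_comm]
    · have hc := ih (by simpa [h] using hi)
      set Y := average e l X
      have ha := he.anti i a h
      have ha' := he.anti a i (Ne.symm h)
      rw [mul_add, add_mul, hc]
      congr 1
      calc e i * (e a * Y * e a) = (e i * e a) * Y * e a := by noncomm_ring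
        _ = -(e a * (e i * Y) * e a) := by rw [ha]; noncomm_ring
        _ = -(e a * Y * (e i * e a)) := by rw [hc]; noncomm_ring
        _ = e a * Y * e a * e i := by rw [ha]; noncomm_ring

lemma average_of_commute (he : IsAnticommuting e) (hs : ∀ i, (e i).transpose = e i) (l : List ι)
    {X : Matrix n n ℝ} (hX : ∀ i, e i * X = X * e i) :
    average e l X = (2 : ℝ) ^ l.length • X := by
  induction l with
  | nil => simp [average_nil]
  | cons a l ih =>
    rw [average_cons hs, ih, mul_smul_comm, smul_mul_assoc, hX, mul_assoc, he.sq, mul_one,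
      List.length_cons, pow_succ, mul_smul, two_smul, smul_add]

lemma sublists'_eq_nil_cons {α : Type*} (l : List α) (hl : l.Nodup) :
    ∃ R : List (List α), l.sublists' = [] :: R ∧ ∀ L ∈ R, L ≠ [] ∧ L.Nodup := by
  induction l with
  | nil => exact ⟨[], by simp⟩
  | cons a l ih =>
    rw [List.nodup_cons] at hl
    obtain ⟨R, hR, h⟩ := ih hl.2
    refine ⟨R ++ l.sublists'.map (List.cons a), by rw [List.sublists'_cons, hR]; rfl, ?_⟩
    intro L hL
    rw [List.mem_append, List.mem_map] at hL
    rcases hL with hL | ⟨M, hM, rfl⟩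
    · exact h L hL
    · rw [List.mem_sublists'] at hM
      exact ⟨by simp, List.nodup_cons.2 ⟨fun h => hl.1 (hM.subset h), hM.nodup hl.2⟩⟩

lemma trace_eq_zero_of_anticommute {g M : Matrix n n ℝ} (hg : g * g = 1)
    (h : g * M = -(M * g)) : M.trace = 0 := by
  have h1 : (g * M * g).trace = M.trace := by
    rw [Matrix.trace_mul_comm, ← mul_assoc, hg, one_mul]
  rw [h, neg_mul, mul_assoc, hg, mul_one, Matrix.trace_neg] at h1
  linarith

/-- A nonempty product anticommutes with one of the involutions: with any of its factors if its
length is even, with any involution that is not a factor if its length is odd. The latter exists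
because the total number is even. -/
lemma trace_prod_eq_zero [Fintype ι] (he : IsAnticommuting e) (hN : Even (Fintype.card ι))
    {L : List ι} (hL : L.Nodup) (h0 : L ≠ []) : (L.map e).prod.trace = 0 := by
  rcases Nat.even_or_odd L.length with h | h
  · obtain ⟨i, hi⟩ := List.exists_mem_of_ne_nil L h0
    refine trace_eq_zero_of_anticommute (he.sq i) ?_
    rw [he.mul_prod_of_mem hL hi, h.neg_one_pow, one_mul]
  · have : ∃ i, i ∉ L := by
      classical
      by_contra! hc
      have : L.toFinset = Finset.univ := by ext i; simp [hc]
      have h2 := List.toFinset_card_of_nodup hL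
      rw [this, Finset.card_univ] at h2
      rw [h2] at hN
      exact (Nat.not_even_iff_odd.2 h) hN
    obtain ⟨i, hi⟩ := this
    refine trace_eq_zero_of_anticommute (he.sq i) ?_
    rw [he.mul_prod_of_notMem hi, h.neg_one_pow, neg_one_mul]

/-- The product `g` contributes `tr g * tr gᵀ`, which vanishes except for the empty product. -/
lemma trace_average [Fintype ι] (he : IsAnticommuting e) (hN : Even (Fintype.card ι))
    {l : List ι} (hl : l.Nodup) :
    LinearMap.trace ℝ _ (average e l) = (Fintype.card n : ℝ) ^ 2 := by
  obtain ⟨R, hR, h⟩ := sublists'_eq_nil_cons l hl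
  rw [average, map_list_sum, hR, List.map_map, List.map_cons, List.sum_cons, List.sum_eq_zero]
  · simp only [Function.comp_apply, trace_mulLeftRight]
    simp [sq]
  · intro x hx
    obtain ⟨L, hL, rfl⟩ := List.mem_map.1 hx
    simp only [Function.comp_apply, trace_mulLeftRight]
    rw [trace_prod_eq_zero he hN (h L hL).2 (h L hL).1, zero_mul]

lemma trace_average_transpose (he : IsAnticommuting e) {l : List ι} (hl : l.Nodup) :
    LinearMap.trace ℝ _ (average e l ∘ₗ (Matrix.transposeLinearEquiv n n ℝ ℝ).toLinearMap) =
      signSum l 0 * Fintype.card n := by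
  have h : average e l ∘ₗ (Matrix.transposeLinearEquiv n n ℝ ℝ).toLinearMap =
      (l.sublists'.map fun L => LinearMap.mulLeftRight ℝ ((L.map e).prod,
        (L.map e).prod.transpose) ∘ₗ (Matrix.transposeLinearEquiv n n ℝ ℝ).toLinearMap).sum := by
    unfold average
    induction l.sublists' with
    | nil => simp
    | cons a l ih => simp [LinearMap.add_comp, ih]
  rw [h, map_list_sum, List.map_map, signSum, ← List.sum_map_mul_right]
  refine congrArg List.sum (List.map_congr_left fun L hL => ?_)
  simp only [Function.comp_apply, trace_mulLeftRight_transpose, Matrix.transpose_transpose]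
  rw [he.prod_mul_prod ((List.mem_sublists'.1 hL).nodup hl), add_zero]
  rcases Nat.even_or_odd (L.length.choose 2) with h | h <;> simp [h.neg_one_pow]

end Averaging


/-! ### The commutant of the involutions is the algebra of quaternions -/

lemma nonempty_quaternion_algEquiv {A : Type*} [Ring A] [Algebra ℝ A]
    (hdim : Module.finrank ℝ A = 4) {I J : A} (hI : I * I = -1) (hJ : J * J = -1)
    (hIJ : J * I = -(I * J)) : Nonempty (ℍ[ℝ] ≃ₐ[ℝ] A) := by
  let q : QuaternionAlgebra.Basis A (-1 : ℝ) 0 (-1) :=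
    { i := I, j := J, k := I * J, i_mul_i := by simp [hI], j_mul_j := by simp [hJ]
      i_mul_j := rfl, j_mul_i := by simp [hIJ] }
  have : Nontrivial A := Module.nontrivial_of_finrank_pos (R := ℝ) (by omega)
  have : FiniteDimensional ℝ A := Module.finite_of_finrank_pos (by omega)
  let f : ℍ[ℝ] →ₐ[ℝ] A := q.liftHom
  -- A ring homomorphism from a division ring to a nontrivial ring is injective.
  have hf : Function.Injective f := RingHom.injective (f : ℍ[ℝ] →+* A)
  have hs : Function.Surjective f :=
    (LinearMap.injective_iff_surjective_of_finrank_eq_finrank (f := f.toLinearMap)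
      (by rw [Quaternion.finrank_eq_four, hdim])).1 hf
  exact ⟨AlgEquiv.ofBijective f ⟨hf, hs⟩⟩

section Centralizer

variable {ι n : Type*} [Fintype n] [DecidableEq n] {e : ι → Matrix n n ℝ}

lemma mem_centralizer_range {A : Matrix n n ℝ} :
    A ∈ Subalgebra.centralizer ℝ (Set.range e) ↔ ∀ i, e i * A = A * e i := by
  simp [Subalgebra.mem_centralizer_iff]

lemma transpose_mem_centralizer (hs : ∀ i, (e i).transpose = e i) {A : Matrix n n ℝ}
    (hA : A ∈ Subalgebra.centralizer ℝ (Set.range e)) :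
    A.transpose ∈ Subalgebra.centralizer ℝ (Set.range e) := by
  rw [mem_centralizer_range] at hA ⊢
  intro i
  have := congrArg Matrix.transpose (hA i)
  rw [Matrix.transpose_mul, Matrix.transpose_mul, hs] at this
  exact this.symm

lemma finrank_centralizer [Fintype ι] [Nonempty n] (he : IsAnticommuting e)
    (hs : ∀ i, (e i).transpose = e i) (hN : Fintype.card ι % 8 = 4)
    (hscal : ∀ A ∈ Subalgebra.centralizer ℝ (Set.range e), A.transpose = A →
      ∃ c : ℝ, A = c • 1) :
    Module.finrank ℝ (Subalgebra.centralizer ℝ (Set.range e)) = 4 := by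
  set D := Subalgebra.centralizer ℝ (Set.range e) with hD
  set l : List ι := Finset.univ.toList with hl
  have hnd : l.Nodup := Finset.nodup_toList _
  have hmem : ∀ i, i ∈ l := fun i => by simp [hl]
  have hlen : l.length = Fintype.card ι := by simp [hl]
  obtain ⟨k, hk⟩ : ∃ k, Fintype.card ι = 4 * (2 * k + 1) :=
    ⟨Fintype.card ι / 8, by omega⟩
  have hev : Even (Fintype.card ι) := ⟨2 * (2 * k + 1), by omega⟩
  set c : ℝ := 4 ^ (2 * k + 1) with hc
  have hc0 : 0 < c := by positivity
  have hpow : (2 : ℝ) ^ l.length = c ^ 2 := by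
    rw [hlen, hk, hc, ← pow_mul, pow_mul, mul_comm (2 * k + 1) 2, pow_mul]
    norm_num
  -- The exponent `2 k + 1` is odd because the number of involutions is 4, not 0, modulo 8.
  have hsign : signSum l 0 = -c := by
    rw [(signSum_of_length (2 * k + 1) l (by rw [hlen, hk])).1, Odd.neg_pow ⟨k, rfl⟩]
  have hP : LinearMap.IsProj (Subalgebra.toSubmodule D) ((c ^ 2)⁻¹ • average e l) := by
    constructor
    · intro X
      refine Submodule.smul_mem _ _ ?_
      exact mem_centralizer_range.2 fun i => commute_average he hs l X (hmem i)
    · intro X hX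
      rw [LinearMap.smul_apply, average_of_commute he hs l (mem_centralizer_range.1 hX), hpow,
        smul_smul, inv_mul_cancel₀ (by positivity), one_smul]
  -- The average of the symmetric matrix `X + Xᵀ` is a symmetric element of the commutant, hence a
  -- scalar; the factor `2 c²` is the value of the unnormalised map on scalars.
  have hQ : LinearMap.IsProj (Submodule.span ℝ {(1 : Matrix n n ℝ)})
      ((2 * c ^ 2)⁻¹ • (average e l + average e l ∘ₗ
        (Matrix.transposeLinearEquiv n n ℝ ℝ).toLinearMap)) := by
    constructor
    · intro X
      refine Submodule.smul_mem _ _ ?_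
      obtain ⟨r, hr⟩ := hscal (average e l (X + X.transpose))
        (mem_centralizer_range.2 fun i => commute_average he hs l _ (hmem i))
        (by rw [transpose_average hs, Matrix.transpose_add, Matrix.transpose_transpose, add_comm])
      rw [map_add] at hr
      exact Submodule.mem_span_singleton.2 ⟨r, hr.symm⟩
    · intro X hX
      obtain ⟨r, rfl⟩ := Submodule.mem_span_singleton.1 hX
      have h1 : average e l (1 : Matrix n n ℝ) = c ^ 2 • 1 := by
        rw [average_of_commute he hs l (by simp), hpow]
      have h2 : (Matrix.transposeLinearEquiv n n ℝ ℝ).toLinearMap (r • 1) = r • 1 := by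
        change (r • (1 : Matrix n n ℝ)).transpose = _
        simp
      rw [LinearMap.smul_apply, LinearMap.add_apply, LinearMap.comp_apply, h2, map_smul, h1,
        ← two_smul ℝ, smul_comm r, smul_smul, smul_smul, mul_assoc, inv_mul_cancel₀ (by positivity),
        one_smul]
  have tP := hP.trace
  have tQ := hQ.trace
  rw [finrank_span_singleton (one_ne_zero), map_smul, map_add, trace_average he hev hnd,
    trace_average_transpose he hnd, hsign, smul_eq_mul] at tQ
  rw [map_smul, trace_average he hev hnd, smul_eq_mul] at tP
  set m : ℝ := (Fintype.card n : ℝ)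
  have hm : 0 ≤ m := Nat.cast_nonneg _
  -- The rank of the second projection is 1, which reads `m² - c m = 2 c²`; positivity then excludes
  -- the root `-c`.
  have h2 : (m - 2 * c) * (m + c) = 0 := by
    field_simp at tQ
    push_cast at tQ
    linear_combination tQ
  have h3 : m = 2 * c := by
    rcases mul_eq_zero.1 h2 with h | h <;> linarith
  rw [h3] at tP
  have h4 : ((Module.finrank ℝ (Subalgebra.toSubmodule D) : ℕ) : ℝ) = (4 : ℕ) := by
    rw [← tP]; field_simp; norm_num
  exact_mod_cast h4

/-- The square `A * A = -Aᵀ A` is symmetric, hence scalar, and it is negative because the diagonal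
entries of `Aᵀ A` are sums of squares; rescaling normalises it. -/
lemma exists_smul_mul_self_eq_neg_one
    (hscal : ∀ A ∈ Subalgebra.centralizer ℝ (Set.range e), A.transpose = A →
      ∃ c : ℝ, A = c • 1)
    {A : Matrix n n ℝ} (hA : A ∈ Subalgebra.centralizer ℝ (Set.range e))
    (hskew : A.transpose = -A) (h0 : A ≠ 0) : ∃ s : ℝ, (s • A) * (s • A) = -1 := by
  obtain ⟨c, hc⟩ := hscal (A * A) (mul_mem hA hA) (by
    rw [Matrix.transpose_mul, hskew, neg_mul_neg])
  have hneg : c < 0 := by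
    obtain ⟨i, j, hij⟩ : ∃ i j, A i j ≠ 0 := by
      by_contra! h
      exact h0 (Matrix.ext h)
    have h1 : (A.transpose * A) j j = -c := by
      rw [hskew, neg_mul, hc]; simp
    rw [Matrix.mul_apply] at h1
    have h2 : 0 < ∑ k, A.transpose j k * A k j := by
      refine Finset.sum_pos' (fun k _ => mul_self_nonneg (A k j)) ⟨i, Finset.mem_univ _, ?_⟩
      exact mul_self_pos.2 hij
    linarith
  refine ⟨(√(-c))⁻¹, ?_⟩
  have h3 : √(-c) * √(-c) = -c := Real.mul_self_sqrt (by linarith)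
  rw [smul_mul_smul_comm, hc, smul_smul, ← mul_inv, h3]
  have : (-c)⁻¹ * c = -1 := by rw [inv_neg, neg_mul, inv_mul_cancel₀ hneg.ne]
  rw [this, neg_one_smul]

theorem nonempty_quaternion_algEquiv_centralizer [Fintype ι] [Nonempty n] (he : IsAnticommuting e)
    (hs : ∀ i, (e i).transpose = e i) (hN : Fintype.card ι % 8 = 4)
    (hscal : ∀ A ∈ Subalgebra.centralizer ℝ (Set.range e), A.transpose = A →
      ∃ c : ℝ, A = c • 1) :
    Nonempty (ℍ[ℝ] ≃ₐ[ℝ] Subalgebra.centralizer ℝ (Set.range e)) := by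
  have hdim := finrank_centralizer he hs hN hscal
  set D := Subalgebra.centralizer ℝ (Set.range e) with hD
  have hskew : ∀ A ∈ D, ∃ c : ℝ, ∃ K ∈ D, K.transpose = -K ∧ A = c • 1 + K := fun A hA => by
    have hT := transpose_mem_centralizer hs hA
    obtain ⟨c, hc⟩ := hscal ((1 / 2 : ℝ) • (A + A.transpose))
      (Subalgebra.smul_mem _ (add_mem hA hT) _) (by simp [add_comm])
    refine ⟨c, (1 / 2 : ℝ) • (A - A.transpose), Subalgebra.smul_mem _ (sub_mem hA hT) _,
      by simp [← smul_neg], ?_⟩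
    rw [← hc]
    module
  -- In dimension 4 some element lies outside the span of fewer than four matrices. This is applied
  -- to `{1}` and `{1, I}`, so that the skew parts found are nonzero, the second one even modulo
  -- `I`.
  have hex : ∀ s : Finset (Matrix n n ℝ), s.card < 4 →
      ∃ A ∈ D, A ∉ Submodule.span ℝ (s : Set (Matrix n n ℝ)) := fun s hcard => by
    by_contra! h
    have h1 : Subalgebra.toSubmodule D ≤ Submodule.span ℝ (s : Set (Matrix n n ℝ)) := h
    have h2 := Submodule.finrank_mono h1
    have h3 : Module.finrank ℝ (Submodule.span ℝ (s : Set (Matrix n n ℝ))) ≤ s.card :=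
      finrank_span_finset_le_card (R := ℝ) s
    have h4 : Module.finrank ℝ (Subalgebra.toSubmodule D) = 4 := hdim
    omega
  obtain ⟨A, hA, hA1⟩ := hex {1} (by simp)
  obtain ⟨c, I', hI'D, hI's, rfl⟩ := hskew A hA
  have hI0 : I' ≠ 0 := by
    rintro rfl
    refine hA1 ?_
    rw [add_zero]
    exact Submodule.smul_mem _ _ (Submodule.subset_span (by simp))
  obtain ⟨s, hI⟩ := exists_smul_mul_self_eq_neg_one hscal hI'D hI's hI0
  set I := s • I' with hIdef
  have hID : I ∈ D := Subalgebra.smul_mem _ hI'D _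
  have hIs : I.transpose = -I := by rw [hIdef, Matrix.transpose_smul, hI's, smul_neg]
  obtain ⟨A', hA', hA'1⟩ := hex {1, I} (lt_of_le_of_lt (Finset.card_le_two) (by norm_num))
  obtain ⟨c', J₁, hJ₁D, hJ₁s, rfl⟩ := hskew A' hA'
  -- A Gram–Schmidt step: the anticommutator of `I` and `J₁` is the scalar `t`, and since `I * I =
  -- -1`, adding `(t / 2) • I` to `J₁` makes it vanish.
  obtain ⟨t, ht⟩ := hscal (I * J₁ + J₁ * I) (add_mem (mul_mem hID hJ₁D) (mul_mem hJ₁D hID)) (by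
    simp only [Matrix.transpose_add, Matrix.transpose_mul, hIs, hJ₁s, neg_mul_neg]
    rw [add_comm])
  obtain ⟨r, hJ⟩ := exists_smul_mul_self_eq_neg_one hscal (A := J₁ + (t / 2) • I)
    (add_mem hJ₁D (Subalgebra.smul_mem _ hID _)) (by simp [hIs, hJ₁s, add_comm]) (by
      intro h
      refine hA'1 ?_
      have : J₁ = -(t / 2) • I := by rw [neg_smul]; exact eq_neg_of_add_eq_zero_left h
      rw [this]
      exact add_mem (Submodule.smul_mem _ _ (Submodule.subset_span (by simp)))
        (Submodule.smul_mem _ _ (Submodule.subset_span (by simp))))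
  have hanti : (r • (J₁ + (t / 2) • I)) * I = -(I * (r • (J₁ + (t / 2) • I))) := by
    rw [eq_neg_iff_add_eq_zero]
    simp only [smul_mul_assoc, mul_smul_comm, add_mul, mul_add, hI, ← smul_add]
    have : J₁ * I = t • 1 - I * J₁ := by rw [← ht]; abel
    rw [this]
    module
  refine nonempty_quaternion_algEquiv hdim (I := (⟨I, hID⟩ : D))
    (J := ⟨r • (J₁ + (t / 2) • I), Subalgebra.smul_mem _
      (add_mem hJ₁D (Subalgebra.smul_mem _ hID _)) _⟩) ?_ ?_ ?_
  · exact Subtype.ext hI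
  · exact Subtype.ext hJ
  · exact Subtype.ext hanti

end Centralizer


/-! ### Schur's lemma and invariant inner products on the spinor module -/

section Spinors

variable {E : Type*} [NormedAddCommGroup E] [InnerProductSpace ℝ E]
variable {S : Type*} [AddCommGroup S] [Module ℝ S] [Module (Cl E) S] [IsScalarTower ℝ (Cl E) S]

lemma cmul_mul_self (x : E) : cmul S x * cmul S x = (inner ℝ x x : ℝ) • 1 :=
  LinearMap.ext fun s => by simp [cmul_cmul]

lemma cmul_mul_cmul_add (x y : E) :
    cmul S x * cmul S y + cmul S y * cmul S x = (2 * inner ℝ x y : ℝ) • 1 := by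
  have h := cmul_mul_self (S := S) (x + y)
  rw [map_add, add_mul, mul_add, mul_add, cmul_mul_self, cmul_mul_self, inner_add_left,
    inner_add_right, inner_add_right, real_inner_comm x y] at h
  rw [← sub_eq_zero] at h ⊢
  rw [← h]
  module

lemma cmul_mul_cmul_of_inner_eq_zero {x y : E} (h : inner ℝ x y = (0 : ℝ)) :
    cmul S x * cmul S y = -(cmul S y * cmul S x) := by
  rw [eq_neg_iff_add_eq_zero, cmul_mul_cmul_add, h, mul_zero, zero_smul]

lemma isAnticommuting_cmul {ι : Type*} [Fintype ι] (e : OrthonormalBasis ι ℝ E) :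
    IsAnticommuting fun i => cmul S (e i) where
  sq i := by
    rw [cmul_mul_self, real_inner_self_eq_norm_sq, e.norm_eq_one]; simp
  anti i j h := cmul_mul_cmul_of_inner_eq_zero (e.inner_eq_zero h)

lemma mem_evenSchur {A : Module.End ℝ S} :
    A ∈ evenSchur E S ↔ ∀ x : E, cmul S x * A = A * cmul S x := by
  simp [evenSchur, Subalgebra.mem_centralizer_iff]

lemma mem_evenSchur_iff_basis {ι : Type*} [Fintype ι] (e : OrthonormalBasis ι ℝ E)
    {A : Module.End ℝ S} :
    A ∈ evenSchur E S ↔ ∀ i, cmul S (e i) * A = A * cmul S (e i) := by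
  rw [mem_evenSchur]
  refine ⟨fun h i => h _, fun h x => ?_⟩
  rw [← e.sum_repr x, map_sum, Finset.sum_mul, Finset.mul_sum]
  refine Finset.sum_congr rfl fun i _ => ?_
  rw [map_smul, smul_mul_assoc, mul_smul_comm, h]

variable (E) in
lemma eq_bot_or_eq_top_of_cmul_mem [IsSimpleModule (Cl E) S] (W : Submodule ℝ S)
    (hW : ∀ x : E, ∀ s ∈ W, cmul S x s ∈ W) : W = ⊥ ∨ W = ⊤ := by
  have h : ∀ (a : Cl E) (s : S), s ∈ W → a • s ∈ W := fun a => by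
    induction a using CliffordAlgebra.induction with
    | algebraMap r => intro s hs; rw [algebraMap_smul]; exact W.smul_mem _ hs
    | ι x => exact hW x
    | mul a b ha hb => intro s hs; rw [mul_smul]; exact ha _ (hb _ hs)
    | add a b ha hb => intro s hs; rw [add_smul]; exact W.add_mem (ha _ hs) (hb _ hs)
  let W' : Submodule (Cl E) S := { W with smul_mem' := fun a s hs => h a s hs }
  rcases eq_bot_or_eq_top W' with h' | h'
  · left
    ext s
    change s ∈ W' ↔ _
    rw [h']; rfl
  · right
    ext s
    change s ∈ W' ↔ _
    rw [h']; simp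

/-- Passing from `W` to `W ⊔ c a W` gives stability under the involution `c a`, and keeps stability
under the earlier `c i` because these anticommute with `c a`. -/
lemma exists_finite_submodule_stable {ι : Type*} {c : ι → Module.End ℝ S} (hc : IsAnticommuting c)
    (s : S) (l : List ι) : ∃ W : Submodule ℝ S, FiniteDimensional ℝ W ∧ s ∈ W ∧
      ∀ i ∈ l, ∀ t ∈ W, c i t ∈ W := by
  induction l with
  | nil => exact ⟨Submodule.span ℝ {s}, inferInstance, Submodule.mem_span_singleton_self s, by simp⟩
  | cons a l ih =>
    obtain ⟨W, hf, hs, hW⟩ := ih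
    refine ⟨W ⊔ W.map (c a), inferInstance, Submodule.mem_sup_left hs, ?_⟩
    have hmem : ∀ i, (∀ t ∈ W, c i t ∈ W ⊔ W.map (c a) ∧ c i (c a t) ∈ W ⊔ W.map (c a)) →
        ∀ t ∈ W ⊔ W.map (c a), c i t ∈ W ⊔ W.map (c a) := by
      intro i h t ht
      obtain ⟨u, hu, v, hv, rfl⟩ := Submodule.mem_sup.1 ht
      obtain ⟨w, hw, rfl⟩ := hv
      rw [map_add]
      exact add_mem (h u hu).1 (h w hw).2
    intro i hi
    refine hmem i fun t ht => ?_
    by_cases h : i = a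
    · subst h
      refine ⟨Submodule.mem_sup_right (Submodule.mem_map_of_mem ht), Submodule.mem_sup_left ?_⟩
      have := LinearMap.congr_fun (hc.sq i) t
      rw [Module.End.mul_apply, Module.End.one_apply] at this
      rwa [this]
    · have hil : i ∈ l := by simpa [h] using hi
      refine ⟨Submodule.mem_sup_left (hW i hil t ht), Submodule.mem_sup_right ?_⟩
      have := LinearMap.congr_fun (hc.anti i a h) t
      rw [Module.End.mul_apply, LinearMap.neg_apply, Module.End.mul_apply] at this
      rw [this]
      exact neg_mem (Submodule.mem_map_of_mem (hW i hil t ht))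

variable (E S) in
lemma finiteDimensional_of_isSimpleModule [FiniteDimensional ℝ E] [IsSimpleModule (Cl E) S] :
    FiniteDimensional ℝ S := by
  have : Nontrivial S := IsSimpleModule.nontrivial (Cl E) S
  obtain ⟨s, hs⟩ := exists_ne (0 : S)
  let e := stdOrthonormalBasis ℝ E
  obtain ⟨W, hf, hsW, hW⟩ := exists_finite_submodule_stable (isAnticommuting_cmul (S := S) e) s
    Finset.univ.toList
  rcases eq_bot_or_eq_top_of_cmul_mem E W (fun x t ht => by
    rw [← e.sum_repr x, map_sum, LinearMap.sum_apply]
    refine W.sum_mem fun i _ => ?_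
    rw [map_smul]
    exact W.smul_mem _ (hW i (by simp) t ht)) with h | h
  · rw [h, Submodule.mem_bot] at hsW
    exact absurd hsW hs
  · rw [h] at hf
    exact Module.finite_def.2 (Submodule.fg_top _ |>.1 (Module.finite_def.1 hf))

/-- Schur's lemma for an endomorphism with a real eigenvalue. -/
lemma eq_smul_one_of_hasEigenvalue [IsSimpleModule (Cl E) S] {A : Module.End ℝ S}
    (hA : A ∈ evenSchur E S) {c : ℝ} (hc : A.HasEigenvalue c) : A = c • 1 := by
  rw [mem_evenSchur] at hA
  rcases eq_bot_or_eq_top_of_cmul_mem E (A.eigenspace c) (fun x s hs => by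
    rw [Module.End.mem_eigenspace_iff] at hs ⊢
    have := LinearMap.congr_fun (hA x) s
    rw [Module.End.mul_apply, Module.End.mul_apply, hs, map_smul] at this
    exact this.symm) with h | h
  · exact absurd h hc
  · refine LinearMap.ext fun s => ?_
    have : s ∈ A.eigenspace c := by rw [h]; trivial
    simpa using Module.End.mem_eigenspace_iff.1 this

/-- An inner product for which finitely many anticommuting involutions are isometries. -/
lemma exists_invariant_core {V : Type*} [AddCommGroup V] [Module ℝ V] [FiniteDimensional ℝ V]
    {ι : Type*} {c : ι → Module.End ℝ V} (hc : IsAnticommuting c) (l : List ι) :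
    ∃ B : LinearMap.BilinForm ℝ V, (∀ x y, B x y = B y x) ∧ (∀ x, x ≠ 0 → 0 < B x x) ∧
      ∀ i ∈ l, ∀ x y, B (c i x) (c i y) = B x y := by
  induction l with
  | nil =>
    let f := Module.finBasis ℝ V
    refine ⟨∑ i, (LinearMap.mul ℝ ℝ).compl₁₂ (f.coord i) (f.coord i), fun x y => ?_,
      fun x hx => ?_, by simp⟩
    · simp [mul_comm]
    · simp only [LinearMap.sum_apply, LinearMap.compl₁₂_apply, LinearMap.mul_apply']
      obtain ⟨i, hi⟩ : ∃ i, f.coord i x ≠ 0 := by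
        by_contra! h
        exact hx (f.ext_elem_iff.2 fun i => by simpa using h i)
      exact Finset.sum_pos' (fun i _ => mul_self_nonneg _) ⟨i, Finset.mem_univ _, mul_self_pos.2 hi⟩
  | cons a l ih =>
    obtain ⟨B, hs, hp, hB⟩ := ih
    have hsq : ∀ i x, c i (c i x) = x := fun i x => LinearMap.congr_fun (hc.sq i) x
    -- Symmetrising under `c a` keeps the invariance under the earlier involutions: anticommutation
    -- costs a sign in each of the two arguments.
    refine ⟨B + B.compl₁₂ (c a) (c a), fun x y => ?_, fun x hx => ?_, fun i hi x y => ?_⟩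
    · simp only [LinearMap.add_apply, LinearMap.compl₁₂_apply]
      rw [hs, hs (c a x)]
    · have h0 : c a x ≠ 0 := fun h => hx (by rw [← hsq a x, h, map_zero])
      simp only [LinearMap.add_apply, LinearMap.compl₁₂_apply]
      linarith [hp x hx, hp _ h0]
    · simp only [LinearMap.add_apply, LinearMap.compl₁₂_apply]
      by_cases h : i = a
      · subst h
        rw [hsq, hsq, add_comm]
      · have hil : i ∈ l := by simpa [h] using hi
        have ha : ∀ x, c a (c i x) = -c i (c a x) := fun x =>
          LinearMap.congr_fun (hc.anti a i (Ne.symm h)) x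
        rw [ha, ha, map_neg, map_neg, LinearMap.neg_apply, neg_neg, hB i hil, hB i hil]

end Spinors

/-! ### The even Schur algebra -/

section EvenSchur

variable {E : Type*} [NormedAddCommGroup E] [InnerProductSpace ℝ E] [FiniteDimensional ℝ E]

/-- Isometric involutions are self-adjoint, so in an orthonormal basis of `S` the vectors of the
basis of `E` become symmetric matrices and the matrix result applies. -/
lemma nonempty_quaternion_algEquiv_evenSchur_of_isometry
    (hdim : Module.finrank ℝ E % 8 = 4) {S : Type*} [NormedAddCommGroup S] [InnerProductSpace ℝ S]
    [Module (Cl E) S] [IsScalarTower ℝ (Cl E) S] [IsSimpleModule (Cl E) S]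
    (hiso : ∀ i (x y : S), inner ℝ (cmul S (stdOrthonormalBasis ℝ E i) x)
      (cmul S (stdOrthonormalBasis ℝ E i) y) = (inner ℝ x y : ℝ)) :
    Nonempty (ℍ[ℝ] ≃ₐ[ℝ] evenSchur E S) := by
  have : FiniteDimensional ℝ S := finiteDimensional_of_isSimpleModule E S
  have : Nontrivial S := IsSimpleModule.nontrivial (Cl E) S
  set e := stdOrthonormalBasis ℝ E
  let v := stdOrthonormalBasis ℝ S
  have : Nonempty (Fin (Module.finrank ℝ S)) := ⟨⟨0, Module.finrank_pos⟩⟩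
  let m := LinearMap.toMatrixOrthonormal v
  have hanti := isAnticommuting_cmul (S := S) e
  have hm : IsAnticommuting fun i => m (cmul S (e i)) :=
    ⟨fun i => by rw [← map_mul, hanti.sq, map_one],
      fun i j h => by rw [← map_mul, hanti.anti i j h, map_neg, map_mul]⟩
  have hadj : ∀ i (x y : S), inner ℝ (cmul S (e i) x) y = (inner ℝ x (cmul S (e i) y) : ℝ) := by
    intro i x y
    rw [← hiso i x, ← Module.End.mul_apply (cmul S (e i)), hanti.sq, Module.End.one_apply]
  have hsymm : ∀ i, (m (cmul S (e i))).transpose = m (cmul S (e i)) := by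
    intro i
    ext j k
    rw [Matrix.transpose_apply, LinearMap.toMatrixOrthonormal_apply_apply,
      LinearMap.toMatrixOrthonormal_apply_apply, ← hadj, real_inner_comm]
  have hmap : (evenSchur E S).map (m.toAlgEquiv : Module.End ℝ S →ₐ[ℝ] _) =
      Subalgebra.centralizer ℝ (Set.range fun i => m (cmul S (e i))) := by
    ext A
    rw [mem_centralizer_range]
    constructor
    · rintro ⟨A, hA, rfl⟩ i
      have := congrArg m ((mem_evenSchur_iff_basis e).1 hA i)
      rwa [map_mul, map_mul] at this
    · intro h
      refine ⟨m.symm A, (mem_evenSchur_iff_basis e).2 fun i => m.injective ?_, m.apply_symm_apply A⟩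
      have := h i
      rw [← m.apply_symm_apply A, ← map_mul, ← map_mul] at this
      exact this
  obtain ⟨φ⟩ := nonempty_quaternion_algEquiv_centralizer hm hsymm (by simpa using hdim) (by
    intro A hA hsA
    rw [← hmap] at hA
    obtain ⟨A, hA', rfl⟩ := hA
    have hAs : A.IsSymmetric := by
      rw [LinearMap.isSymmetric_iff_isSelfAdjoint]
      refine m.injective ?_
      change m (star A) = m A
      rw [map_star, Matrix.star_eq_conjTranspose, Matrix.conjTranspose_eq_transpose_of_trivial]
      exact hsA
    -- A symmetric operator has a real eigenvalue, the supremum of its Rayleigh quotient; Schur's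
    -- lemma then makes it scalar.
    obtain ⟨c, hc⟩ : ∃ c, A.HasEigenvalue c :=
      ⟨_, hAs.hasEigenvalue_iSup_of_finiteDimensional⟩
    refine ⟨c, ?_⟩
    rw [eq_smul_one_of_hasEigenvalue hA' hc]
    change m (c • 1) = _
    rw [map_smul, map_one])
  exact ⟨φ.trans ((Subalgebra.equivOfEq _ _ hmap.symm).trans
    ((evenSchur E S).equivMapOfInjective _ m.toAlgEquiv.injective).symm)⟩

theorem nonempty_quaternion_algEquiv_evenSchur
    (hdim : Module.finrank ℝ E % 8 = 4) {S : Type*} [AddCommGroup S] [Module ℝ S]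
    [Module (Cl E) S] [IsScalarTower ℝ (Cl E) S] [IsSimpleModule (Cl E) S] :
    Nonempty (ℍ[ℝ] ≃ₐ[ℝ] evenSchur E S) := by
  have : FiniteDimensional ℝ S := finiteDimensional_of_isSimpleModule E S
  obtain ⟨B, hs, hp, hB⟩ := exists_invariant_core
    (isAnticommuting_cmul (S := S) (stdOrthonormalBasis ℝ E)) Finset.univ.toList
  let core : InnerProductSpace.Core ℝ S :=
    { inner := fun x y => B x y
      conj_inner_symm := fun x y => hs y x
      re_inner_nonneg := fun x => by
        by_cases h : x = 0
        · simp [h]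
        · exact (hp x h).le
      add_left := fun x y z => by simp
      smul_left := fun x y r => by simp
      definite := fun x hx => by
        by_contra h
        exact (hp x h).ne' hx }
  let _ : NormedAddCommGroup S := core.toNormedAddCommGroup
  let _ : InnerProductSpace ℝ S := InnerProductSpace.ofCore core.toCore
  exact nonempty_quaternion_algEquiv_evenSchur_of_isometry hdim fun i x y => hB i (by simp) x y

end EvenSchur


/-! ### The quaternionic equations as vector algebra in `ℝ³` -/

section Quaternions

/-- The imaginary parts of two quaternions are parallel. -/
def ImParallel (a b : ℍ[ℝ]) : Prop :=
  a.imI * b.imJ = a.imJ * b.imI ∧ a.imJ * b.imK = a.imK * b.imJ ∧ a.imK * b.imI = a.imI * b.imK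

lemma mul_comm_iff_imParallel (a b : ℍ[ℝ]) : a * b = b * a ↔ ImParallel a b := by
  rw [Quaternion.ext_iff]
  simp only [Quaternion.re_mul, Quaternion.imI_mul, Quaternion.imJ_mul, Quaternion.imK_mul]
  constructor
  · rintro ⟨-, h1, h2, h3⟩
    exact ⟨by linear_combination h3 / 2, by linear_combination h1 / 2,
      by linear_combination h2 / 2⟩
  · rintro ⟨h1, h2, h3⟩
    exact ⟨by ring, by linear_combination 2 * h2, by linear_combination 2 * h3,
      by linear_combination 2 * h1⟩

/-- The vanishing of `[v, a] + ε {v, b}`. -/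
def TwistedCommute (ε : ℝ) (v a b : ℍ[ℝ]) : Prop :=
  v * a - a * v + ε • (v * b + b * v) = 0

/-- The commutator is `2 Im v × Im a`; the anticommutator has real part `2 (Re v Re b - Im v · Im
b)` and imaginary part `2 (Re v Im b + Re b Im v)`. Pairing the imaginary equation with `Im v`
removes the cross product, and together with the real equation this gives `|v|² Re b = 0`. -/
lemma twistedCommute_iff {ε : ℝ} (hε : ε = 1 ∨ ε = -1) (v a b : ℍ[ℝ]) (hv : v ≠ 0) :
    TwistedCommute ε v a b ↔
      b.re = 0 ∧ v.imI * b.imI + v.imJ * b.imJ + v.imK * b.imK = 0 ∧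
      v.re * b.imI = -ε * (v.imJ * a.imK - v.imK * a.imJ) ∧
      v.re * b.imJ = -ε * (v.imK * a.imI - v.imI * a.imK) ∧
      v.re * b.imK = -ε * (v.imI * a.imJ - v.imJ * a.imI) := by
  have hε2 : ε * ε = 1 := by rcases hε with rfl | rfl <;> norm_num
  rw [TwistedCommute, Quaternion.ext_iff]
  simp only [Quaternion.re_add, Quaternion.imI_add, Quaternion.imJ_add, Quaternion.imK_add,
    Quaternion.re_sub, Quaternion.imI_sub, Quaternion.imJ_sub, Quaternion.imK_sub,
    Quaternion.re_smul, Quaternion.imI_smul, Quaternion.imJ_smul, Quaternion.imK_smul,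
    Quaternion.re_mul, Quaternion.imI_mul, Quaternion.imJ_mul, Quaternion.imK_mul,
    Quaternion.re_zero, Quaternion.imI_zero, Quaternion.imJ_zero, Quaternion.imK_zero, smul_eq_mul]
  constructor
  · rintro ⟨h0, h1, h2, h3⟩
    have g0 : v.re * b.re = v.imI * b.imI + v.imJ * b.imJ + v.imK * b.imK := by
      linear_combination ε / 2 * h0 - (v.re * b.re - (v.imI * b.imI + v.imJ * b.imJ +
        v.imK * b.imK)) * hε2
    have hre : b.re = 0 := by
      have hn : 0 < v.re ^ 2 + v.imI ^ 2 + v.imJ ^ 2 + v.imK ^ 2 := by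
        have := (Quaternion.normSq_def' v).symm ▸
          (lt_of_le_of_ne (Quaternion.normSq_nonneg (a := v)) (Ne.symm (by simpa using hv)))
        exact this
      have : (v.re ^ 2 + v.imI ^ 2 + v.imJ ^ 2 + v.imK ^ 2) * b.re = 0 := by
        linear_combination v.re * g0 + ε / 2 * (v.imI * h1 + v.imJ * h2 + v.imK * h3) -
          (v.imI * (v.re * b.imI + v.imI * b.re) + v.imJ * (v.re * b.imJ + v.imJ * b.re) +
            v.imK * (v.re * b.imK + v.imK * b.re)) * hε2
      exact (mul_eq_zero.1 this).resolve_left hn.ne'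
    rw [hre, mul_zero] at g0
    refine ⟨hre, g0.symm, ?_, ?_, ?_⟩
    · linear_combination ε / 2 * h1 - (v.re * b.imI + v.imI * b.re) * hε2 - v.imI * hre
    · linear_combination ε / 2 * h2 - (v.re * b.imJ + v.imJ * b.re) * hε2 - v.imJ * hre
    · linear_combination ε / 2 * h3 - (v.re * b.imK + v.imK * b.re) * hε2 - v.imK * hre
  · rintro ⟨h0, hd, h1, h2, h3⟩
    refine ⟨?_, ?_, ?_, ?_⟩
    · linear_combination 2 * ε * v.re * h0 - 2 * ε * hd
    · linear_combination 2 * ε * v.imI * h0 + 2 * ε * h1 -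
        2 * (v.imJ * a.imK - v.imK * a.imJ) * hε2
    · linear_combination 2 * ε * v.imJ * h0 + 2 * ε * h2 -
        2 * (v.imK * a.imI - v.imI * a.imK) * hε2
    · linear_combination 2 * ε * v.imK * h0 + 2 * ε * h3 -
        2 * (v.imI * a.imJ - v.imJ * a.imI) * hε2

/-- The linear map `1 + κ v ×` takes vectors with cross product `p` to vectors with cross product `p
+ κ v × p + κ² (v · p) v`. Its scalar product with `p` is `|p|² + κ² (v · p)²`, so it vanishes only
with `p`. -/
lemma ImParallel.add_smul_cross_iff {κ : ℝ} (v a b a' b' : ℍ[ℝ])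
    (ha : a'.imI = a.imI + κ * (v.imJ * a.imK - v.imK * a.imJ) ∧
      a'.imJ = a.imJ + κ * (v.imK * a.imI - v.imI * a.imK) ∧
      a'.imK = a.imK + κ * (v.imI * a.imJ - v.imJ * a.imI))
    (hb : b'.imI = b.imI + κ * (v.imJ * b.imK - v.imK * b.imJ) ∧
      b'.imJ = b.imJ + κ * (v.imK * b.imI - v.imI * b.imK) ∧
      b'.imK = b.imK + κ * (v.imI * b.imJ - v.imJ * b.imI)) :
    ImParallel a' b' ↔ ImParallel a b := by
  obtain ⟨ha1, ha2, ha3⟩ := ha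
  obtain ⟨hb1, hb2, hb3⟩ := hb
  rw [ImParallel, ImParallel, ha1, ha2, ha3, hb1, hb2, hb3]
  generalize a.imI = a1, a.imJ = a2, a.imK = a3, b.imI = b1, b.imJ = b2, b.imK = b3,
    v.imI = v1, v.imJ = v2, v.imK = v3
  obtain ⟨p1, hp1⟩ : ∃ p, p = a2 * b3 - a3 * b2 := ⟨_, rfl⟩
  obtain ⟨p2, hp2⟩ : ∃ p, p = a3 * b1 - a1 * b3 := ⟨_, rfl⟩
  obtain ⟨p3, hp3⟩ : ∃ p, p = a1 * b2 - a2 * b1 := ⟨_, rfl⟩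
  constructor
  · rintro ⟨h3, h1, h2⟩
    have q1 : p1 + κ * (v2 * p3 - v3 * p2) + κ ^ 2 * v1 * (v1 * p1 + v2 * p2 + v3 * p3) = 0 := by
      rw [hp1, hp2, hp3]; linear_combination h1
    have q2 : p2 + κ * (v3 * p1 - v1 * p3) + κ ^ 2 * v2 * (v1 * p1 + v2 * p2 + v3 * p3) = 0 := by
      rw [hp1, hp2, hp3]; linear_combination h2
    have q3 : p3 + κ * (v1 * p2 - v2 * p1) + κ ^ 2 * v3 * (v1 * p1 + v2 * p2 + v3 * p3) = 0 := by
      rw [hp1, hp2, hp3]; linear_combination h3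
    have hs : p1 ^ 2 + p2 ^ 2 + p3 ^ 2 + (κ * (v1 * p1 + v2 * p2 + v3 * p3)) ^ 2 = 0 := by
      linear_combination p1 * q1 + p2 * q2 + p3 * q3
    have hk := sq_nonneg (κ * (v1 * p1 + v2 * p2 + v3 * p3))
    have z1 : p1 = 0 := pow_eq_zero_iff two_ne_zero |>.1
      (le_antisymm (by linarith [sq_nonneg p2, sq_nonneg p3]) (sq_nonneg p1))
    have z2 : p2 = 0 := pow_eq_zero_iff two_ne_zero |>.1
      (le_antisymm (by linarith [sq_nonneg p1, sq_nonneg p3]) (sq_nonneg p2))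
    have z3 : p3 = 0 := pow_eq_zero_iff two_ne_zero |>.1
      (le_antisymm (by linarith [sq_nonneg p1, sq_nonneg p2]) (sq_nonneg p3))
    exact ⟨by linarith, by linarith, by linarith⟩
  · rintro ⟨h3, h1, h2⟩
    have z1 : p1 = 0 := by linarith
    have z2 : p2 = 0 := by linarith
    have z3 : p3 = 0 := by linarith
    rw [z1] at hp1
    rw [z2] at hp2
    rw [z3] at hp3
    refine ⟨?_, ?_, ?_⟩
    · linear_combination -hp3 - κ * (v1 * hp2 - v2 * hp1) -
        κ ^ 2 * v3 * (v1 * hp1 + v2 * hp2 + v3 * hp3)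
    · linear_combination -hp1 - κ * (v2 * hp3 - v3 * hp2) -
        κ ^ 2 * v1 * (v1 * hp1 + v2 * hp2 + v3 * hp3)
    · linear_combination -hp2 - κ * (v3 * hp1 - v1 * hp3) -
        κ ^ 2 * v2 * (v1 * hp1 + v2 * hp2 + v3 * hp3)

lemma ImParallel.exists_smul {a b : ℍ[ℝ]} (h : ImParallel a b) (ha : a.im ≠ 0) :
    ∃ c : ℝ, c • a.im = b.im := by
  obtain ⟨h3, h1, h2⟩ := h
  have hn : a.imI ^ 2 + a.imJ ^ 2 + a.imK ^ 2 ≠ 0 := by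
    intro h
    refine ha (Quaternion.ext _ _ rfl ?_ ?_ ?_) <;> simp only [Quaternion.imI_im, Quaternion.imJ_im,
      Quaternion.imK_im, Quaternion.imI_zero, Quaternion.imJ_zero, Quaternion.imK_zero] <;>
    nlinarith [sq_nonneg a.imI, sq_nonneg a.imJ, sq_nonneg a.imK]
  refine ⟨(a.imI * b.imI + a.imJ * b.imJ + a.imK * b.imK) /
    (a.imI ^ 2 + a.imJ ^ 2 + a.imK ^ 2), Quaternion.ext _ _ (by simp) ?_ ?_ ?_⟩ <;>
  simp only [Quaternion.imI_im, Quaternion.imJ_im, Quaternion.imK_im, Quaternion.imI_smul,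
    Quaternion.imJ_smul, Quaternion.imK_smul, smul_eq_mul] <;> field_simp
  · linear_combination a.imJ * h3 - a.imK * h2
  · linear_combination -a.imI * h3 + a.imK * h1
  · linear_combination a.imI * h2 - a.imJ * h1

variable {E : Type*} [NormedAddCommGroup E] [InnerProductSpace ℝ E]

lemma finrank_range_imₗ_le_one_iff (f : E →ₗ[ℝ] ℍ[ℝ]) :
    Module.finrank ℝ (LinearMap.range (imₗ ∘ₗ f)) ≤ 1 ↔ ∀ x y, ImParallel (f x) (f y) := by
  constructor
  · intro h x y
    obtain ⟨⟨v, _⟩, hv⟩ := finrank_le_one_iff.1 h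
    obtain ⟨s, hs⟩ := hv ⟨(imₗ ∘ₗ f) x, LinearMap.mem_range_self _ x⟩
    obtain ⟨t, ht⟩ := hv ⟨(imₗ ∘ₗ f) y, LinearMap.mem_range_self _ y⟩
    have hs' : s • v = (f x).im := congrArg Subtype.val hs
    have ht' : t • v = (f y).im := congrArg Subtype.val ht
    have s1 : s * v.imI = (f x).imI := by simpa using congrArg QuaternionAlgebra.imI hs'
    have s2 : s * v.imJ = (f x).imJ := by simpa using congrArg QuaternionAlgebra.imJ hs'
    have s3 : s * v.imK = (f x).imK := by simpa using congrArg QuaternionAlgebra.imK hs'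
    have t1 : t * v.imI = (f y).imI := by simpa using congrArg QuaternionAlgebra.imI ht'
    have t2 : t * v.imJ = (f y).imJ := by simpa using congrArg QuaternionAlgebra.imJ ht'
    have t3 : t * v.imK = (f y).imK := by simpa using congrArg QuaternionAlgebra.imK ht'
    rw [ImParallel, ← s1, ← s2, ← s3, ← t1, ← t2, ← t3]
    refine ⟨?_, ?_, ?_⟩ <;> ring
  · intro h
    by_cases h0 : ∀ x, (f x).im = 0
    · have : imₗ ∘ₗ f = 0 := LinearMap.ext h0
      rw [this, LinearMap.range_zero, finrank_bot]
      norm_num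
    · push Not at h0
      obtain ⟨x, hx⟩ := h0
      refine finrank_le_one (⟨(imₗ ∘ₗ f) x, LinearMap.mem_range_self _ x⟩) ?_
      rintro ⟨_, y, rfl⟩
      obtain ⟨c, hc⟩ := (h x y).exists_smul hx
      exact ⟨c, Subtype.ext hc⟩

lemma re_cross (u v : ℍ[ℝ]) : (cross u v).re = 0 := rfl

lemma imI_cross (u v : ℍ[ℝ]) : (cross u v).imI = u.imJ * v.imK - u.imK * v.imJ := rfl

lemma imJ_cross (u v : ℍ[ℝ]) : (cross u v).imJ = u.imK * v.imI - u.imI * v.imK := rfl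

lemma imK_cross (u v : ℍ[ℝ]) : (cross u v).imK = u.imI * v.imJ - u.imJ * v.imI := rfl

/-- Here `h₄` is determined by `h₃`, and with `κ = ε / Re h₁` one has `Im (h₃ ± h₄) = (1 ∓ κ Im h₁
×) Im h₃`. By `ImParallel.add_smul_cross_iff` either parallelism condition is equivalent to that on
`h₃` alone, so one of them is redundant. -/
lemma firstCase_iff {ε : ℝ} (hε : ε = 1 ∨ ε = -1) {h₁ : ℍ[ℝ]} (hr : h₁.re ≠ 0)
    (h₃ h₄ : E →ₗ[ℝ] ℍ[ℝ]) :
    ((∀ x, TwistedCommute ε h₁ (h₃ x) (h₄ x)) ∧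
      (∀ x y, ImParallel (h₃ x + h₄ x) (h₃ y + h₄ y)) ∧
      ∀ x y, ImParallel (h₃ x - h₄ x) (h₃ y - h₄ y)) ↔ FirstCase ε h₁ h₃ h₄ := by
  have h0 : h₁ ≠ 0 := by rintro rfl; exact hr rfl
  have key : (∀ x, TwistedCommute ε h₁ (h₃ x) (h₄ x)) ↔
      ∀ x, h₄ x = -(ε / h₁.re) • cross h₁.im (h₃ x).im := by
    refine forall_congr' fun x => ?_
    rw [twistedCommute_iff hε _ _ _ h0, Quaternion.ext_iff]
    simp only [re_cross, imI_cross, imJ_cross, imK_cross, Quaternion.re_smul, Quaternion.imI_smul, Quaternion.imJ_smul,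
      Quaternion.imK_smul, Quaternion.imI_im, Quaternion.imJ_im, Quaternion.imK_im, smul_eq_mul,
      mul_zero]
    have hk : ∀ s t : ℝ, h₁.re * s = -ε * t ↔ s = -(ε / h₁.re) * t := fun s t => by
      rw [mul_comm, ← eq_div_iff hr]
      ring_nf
    rw [hk, hk, hk]
    constructor
    · rintro ⟨h, -, h'⟩
      exact ⟨h, h'⟩
    · rintro ⟨h, h1, h2, h3⟩
      refine ⟨h, ?_, h1, h2, h3⟩
      rw [h1, h2, h3]
      ring
  rw [key, FirstCase, finrank_range_imₗ_le_one_iff]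
  have comp : (∀ x, h₄ x = -(ε / h₁.re) • cross h₁.im (h₃ x).im) → ∀ x,
      (h₄ x).imI = -(ε / h₁.re) * (h₁.imJ * (h₃ x).imK - h₁.imK * (h₃ x).imJ) ∧
      (h₄ x).imJ = -(ε / h₁.re) * (h₁.imK * (h₃ x).imI - h₁.imI * (h₃ x).imK) ∧
      (h₄ x).imK = -(ε / h₁.re) * (h₁.imI * (h₃ x).imJ - h₁.imJ * (h₃ x).imI) := by
    intro h x
    rw [h x]
    simp [imI_cross, imJ_cross, imK_cross]
  have hadd : (∀ x, h₄ x = -(ε / h₁.re) • cross h₁.im (h₃ x).im) → ∀ x y,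
      (ImParallel (h₃ x + h₄ x) (h₃ y + h₄ y) ↔ ImParallel (h₃ x) (h₃ y)) := by
    intro h x y
    obtain ⟨a1, a2, a3⟩ := comp h x
    obtain ⟨b1, b2, b3⟩ := comp h y
    refine ImParallel.add_smul_cross_iff (κ := -(ε / h₁.re)) h₁ _ _ _ _ ⟨?_, ?_, ?_⟩
      ⟨?_, ?_, ?_⟩ <;>
    simp only [Quaternion.imI_add, Quaternion.imJ_add, Quaternion.imK_add, a1, a2, a3, b1, b2, b3]
  have hsub : (∀ x, h₄ x = -(ε / h₁.re) • cross h₁.im (h₃ x).im) → ∀ x y,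
      (ImParallel (h₃ x - h₄ x) (h₃ y - h₄ y) ↔ ImParallel (h₃ x) (h₃ y)) := by
    intro h x y
    obtain ⟨a1, a2, a3⟩ := comp h x
    obtain ⟨b1, b2, b3⟩ := comp h y
    refine ImParallel.add_smul_cross_iff (κ := ε / h₁.re) h₁ _ _ _ _ ⟨?_, ?_, ?_⟩
      ⟨?_, ?_, ?_⟩ <;>
    simp only [Quaternion.imI_sub, Quaternion.imJ_sub, Quaternion.imK_sub, a1, a2, a3, b1, b2,
      b3] <;> ring
  constructor
  · rintro ⟨hA, hB, -⟩
    exact ⟨hr, fun x y => (hadd hA x y).1 (hB x y), hA⟩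
  · rintro ⟨-, h, hA⟩
    exact ⟨hA, fun x y => (hadd hA x y).2 (h x y), fun x y => (hsub hA x y).2 (h x y)⟩

/-- Two linear forms with the same kernel are proportional. -/
lemma mul_eq_mul_of_ker_eq {V : Type*} [AddCommGroup V] [Module ℝ V] {c μ : V →ₗ[ℝ] ℝ}
    (h : c ≠ 0 → μ ≠ 0 → LinearMap.ker μ = LinearMap.ker c) (x y : V) : c x * μ y = c y * μ x := by
  by_cases hc : c = 0
  · simp [hc]
  by_cases hμ : μ = 0
  · simp [hμ]
  have hk := h hc hμ
  obtain ⟨z, hz⟩ : ∃ z, c z ≠ 0 := by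
    by_contra! h
    exact hc (LinearMap.ext h)
  have hw : ∀ w, c z * μ w = c w * μ z := fun w => by
    have : c z • w - c w • z ∈ LinearMap.ker μ := by
      rw [hk, LinearMap.mem_ker, map_sub, map_smul, map_smul, smul_eq_mul, smul_eq_mul]
      ring
    rw [LinearMap.mem_ker, map_sub, map_smul, map_smul, smul_eq_mul, smul_eq_mul] at this
    linarith
  refine mul_left_cancel₀ hz ?_
  linear_combination c x * hw y - c y * hw x

lemma exists_quaternion (r a b c : ℝ) :
    ∃ u : ℍ[ℝ], u.re = r ∧ u.imI = a ∧ u.imJ = b ∧ u.imK = c := ⟨⟨r, a, b, c⟩, rfl, rfl, rfl, rfl⟩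

lemma inner_eq_sum (a b : ℍ[ℝ]) : (inner ℝ a b : ℝ) =
    a.re * b.re + a.imI * b.imI + a.imJ * b.imJ + a.imK * b.imK := by
  rw [Quaternion.inner_def]
  simp

lemma exists_unit_orthogonal (v : ℍ[ℝ]) : ∃ ν : ℍ[ℝ], ν.re = 0 ∧ ‖ν‖ = 1 ∧
    inner ℝ v.im ν = (0 : ℝ) := by
  obtain ⟨u, hu, hu0, hv⟩ : ∃ u : ℍ[ℝ], u.re = 0 ∧ u ≠ 0 ∧ inner ℝ v.im u = (0 : ℝ) := by
    by_cases h : v.imI = 0 ∧ v.imJ = 0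
    · obtain ⟨u, u0, u1, u2, u3⟩ := exists_quaternion 0 1 0 0
      refine ⟨u, u0, ?_, ?_⟩
      · rintro rfl
        simp at u1
      · simp [inner_eq_sum, u0, u1, u2, u3, h.1]
    · obtain ⟨u, u0, u1, u2, u3⟩ := exists_quaternion 0 (-v.imJ) v.imI 0
      refine ⟨u, u0, ?_, ?_⟩
      · rintro rfl
        exact h ⟨by simpa using u2.symm, by simpa using u1⟩
      · simp only [inner_eq_sum, u0, u1, u2, u3, Quaternion.re_im, Quaternion.imI_im,
          Quaternion.imJ_im]
        ring
  refine ⟨‖u‖⁻¹ • u, by simp [hu], ?_, by rw [inner_smul_right, hv, mul_zero]⟩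
  rw [norm_smul, norm_inv, norm_norm, inv_mul_cancel₀ (norm_ne_zero_iff.2 hu0)]

/-- With `Re h₁ = 0` the twisted relation says that `Im h₃` is parallel to `Im h₁` and that `h₄` is
imaginary and orthogonal to `Im h₁`. The sum of the two parallelism conditions says that the values
of `h₄` are parallel, their difference that `c x * μ y = c y * μ x`. -/
lemma secondCase_iff {ε : ℝ} (hε : ε = 1 ∨ ε = -1) {h₁ : ℍ[ℝ]} (hr : h₁.re = 0) (hi : h₁.im ≠ 0)
    (h₃ h₄ : E →ₗ[ℝ] ℍ[ℝ]) :
    ((∀ x, TwistedCommute ε h₁ (h₃ x) (h₄ x)) ∧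
      (∀ x y, ImParallel (h₃ x + h₄ x) (h₃ y + h₄ y)) ∧
      ∀ x y, ImParallel (h₃ x - h₄ x) (h₃ y - h₄ y)) ↔ SecondCase h₁ h₃ h₄ := by
  have h0 : h₁ ≠ 0 := by rintro rfl; exact hi rfl
  have hε0 : -ε ≠ 0 := by rcases hε with rfl | rfl <;> norm_num
  have hn : ‖h₁.im‖ ≠ 0 := norm_ne_zero_iff.2 hi
  have hnsq : ‖h₁.im‖ ^ 2 = h₁.imI ^ 2 + h₁.imJ ^ 2 + h₁.imK ^ 2 := by
    rw [← real_inner_self_eq_norm_sq, inner_eq_sum]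
    simp [sq]
  have key : (∀ x, TwistedCommute ε h₁ (h₃ x) (h₄ x)) ↔
      ∀ x, (h₄ x).re = 0 ∧ inner ℝ h₁.im (h₄ x) = (0 : ℝ) ∧ ImParallel h₁ (h₃ x) := by
    refine forall_congr' fun x => ?_
    rw [twistedCommute_iff hε _ _ _ h0, hr, inner_eq_sum]
    simp only [zero_mul, zero_eq_mul, hε0, false_or, sub_eq_zero, Quaternion.re_im,
      Quaternion.imI_im, Quaternion.imJ_im, Quaternion.imK_im, zero_add, ImParallel]
    tauto
  rw [key]
  constructor
  · rintro ⟨hA, hB, hC⟩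
    refine ⟨hr, hi, ?_⟩
    let c : E →ₗ[ℝ] ℝ := ‖h₁.im‖⁻¹ • ((innerₗ ℍ[ℝ] h₁.im) ∘ₗ h₃)
    let r : E →ₗ[ℝ] ℝ := (innerₗ ℍ[ℝ] 1) ∘ₗ h₃
    have hrx : ∀ x, r x = (h₃ x).re := fun x => by
      simp [r, innerₗ_apply_apply, inner_eq_sum]
    have hcx : ∀ x, c x = ‖h₁.im‖⁻¹ * inner ℝ h₁.im (h₃ x) := fun x => by
      simp [c, innerₗ_apply_apply]
    have h3x : ∀ x, h₃ x = (r x : ℍ[ℝ]) + c x • (‖h₁.im‖⁻¹ • h₁.im) := fun x => by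
      obtain ⟨-, -, p3, p1, p2⟩ := hA x
      rw [smul_smul, hrx, hcx]
      have h2 : ∀ t u : ℝ, inner ℝ h₁.im (h₃ x) * u = ‖h₁.im‖ ^ 2 * t →
          t = ‖h₁.im‖⁻¹ * inner ℝ h₁.im (h₃ x) * ‖h₁.im‖⁻¹ * u := fun t u h => by
        field_simp
        linear_combination -h
      refine Quaternion.ext _ _ (by simp) ?_ ?_ ?_ <;>
      simp only [Quaternion.imI_add, Quaternion.imJ_add, Quaternion.imK_add, Quaternion.imI_coe,
        Quaternion.imJ_coe, Quaternion.imK_coe, Quaternion.imI_smul, Quaternion.imJ_smul,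
        Quaternion.imK_smul, Quaternion.imI_im, Quaternion.imJ_im, Quaternion.imK_im, smul_eq_mul,
        zero_add] <;>
      refine h2 _ _ ?_ <;>
      simp only [hnsq, inner_eq_sum, Quaternion.re_im, Quaternion.imI_im, Quaternion.imJ_im,
        Quaternion.imK_im]
      · linear_combination h₁.imJ * p3 - h₁.imK * p2
      · linear_combination h₁.imK * p1 - h₁.imI * p3
      · linear_combination h₁.imI * p2 - h₁.imJ * p1
    have hcomp : ∀ x, (h₃ x).imI = c x * ‖h₁.im‖⁻¹ * h₁.imI ∧
        (h₃ x).imJ = c x * ‖h₁.im‖⁻¹ * h₁.imJ ∧ (h₃ x).imK = c x * ‖h₁.im‖⁻¹ * h₁.imK := fun x => by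
      refine ⟨?_, ?_, ?_⟩ <;> rw [h3x] <;> simp [mul_assoc]
    obtain ⟨ν, hν0, hν1, hν2, μ, hμ⟩ : ∃ ν : ℍ[ℝ], ν.re = 0 ∧ ‖ν‖ = 1 ∧
        inner ℝ h₁.im ν = (0 : ℝ) ∧ ∃ μ : E →ₗ[ℝ] ℝ, ∀ x, h₄ x = μ x • ν := by
      -- If `h₄` vanishes, any unit vector orthogonal to `Im h₁` serves; otherwise `ν` is a
      -- normalised value of `h₄`.
      by_cases hz : h₄ = 0
      · obtain ⟨ν, a, b, c⟩ := exists_unit_orthogonal h₁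
        exact ⟨ν, a, b, c, 0, fun x => by simp [hz]⟩
      · obtain ⟨z, hz⟩ : ∃ z, h₄ z ≠ 0 := by
          by_contra! h
          exact hz (LinearMap.ext h)
        have hzn : ‖h₄ z‖ ≠ 0 := norm_ne_zero_iff.2 hz
        have him : ∀ x, (h₄ x).im = h₄ x := fun x =>
          Quaternion.ext _ _ (by simp [(hA x).1]) (by simp) (by simp) (by simp)
        refine ⟨‖h₄ z‖⁻¹ • h₄ z, by simp [(hA z).1], ?_, by
          rw [inner_smul_right, (hA z).2.1, mul_zero], ‖h₄ z‖⁻¹ • ((innerₗ ℍ[ℝ] (h₄ z)) ∘ₗ h₄),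
          fun x => ?_⟩
        · rw [norm_smul, norm_inv, norm_norm, inv_mul_cancel₀ hzn]
        · have hpar : ImParallel (h₄ z) (h₄ x) := by
            obtain ⟨x1, x2, x3⟩ := hcomp x
            obtain ⟨z1, z2, z3⟩ := hcomp z
            obtain ⟨b3, b1, b2⟩ := hB z x
            obtain ⟨c3, c1, c2⟩ := hC z x
            simp only [Quaternion.imI_add, Quaternion.imJ_add, Quaternion.imK_add,
              Quaternion.imI_sub, Quaternion.imJ_sub, Quaternion.imK_sub, x1, x2, x3, z1, z2,
              z3] at b1 b2 b3 c1 c2 c3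
            exact ⟨by linear_combination (b3 + c3) / 2, by linear_combination (b1 + c1) / 2,
              by linear_combination (b2 + c2) / 2⟩
          obtain ⟨t, ht⟩ := hpar.exists_smul (by rw [him]; exact hz)
          rw [him, him] at ht
          simp only [LinearMap.smul_apply, LinearMap.comp_apply, innerₗ_apply_apply, smul_smul,
            smul_eq_mul]
          rw [← ht, inner_smul_right, real_inner_self_eq_norm_sq]
          congr 1
          field_simp
    refine ⟨r, c, μ, ν, hν0, hν1, hν2, h3x, hμ, fun hc hμ0 => ?_⟩
    have hprod : ∀ x y, c x * μ y = c y * μ x := by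
      intro x y
      obtain ⟨x1, x2, x3⟩ := hcomp x
      obtain ⟨y1, y2, y3⟩ := hcomp y
      obtain ⟨b3, b1, b2⟩ := hB x y
      obtain ⟨c3, c1, c2⟩ := hC x y
      simp only [Quaternion.imI_add, Quaternion.imJ_add, Quaternion.imK_add, hμ,
        Quaternion.imI_sub, Quaternion.imJ_sub, Quaternion.imK_sub, x1, x2, x3, y1, y2, y3,
        Quaternion.imI_smul, Quaternion.imJ_smul, Quaternion.imK_smul, smul_eq_mul]
        at b1 b2 b3 c1 c2 c3
      have hνsq : ν.imI ^ 2 + ν.imJ ^ 2 + ν.imK ^ 2 = 1 := by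
        have := real_inner_self_eq_norm_sq ν
        rw [inner_eq_sum, hν0, hν1] at this
        linear_combination this
      have hort : h₁.imI * ν.imI + h₁.imJ * ν.imJ + h₁.imK * ν.imK = 0 := by
        have := hν2
        rw [inner_eq_sum] at this
        simpa using this
      -- Half the difference of the two conditions is `(c x μ y - c y μ x) / |Im h₁|` times `Im h₁ ×
      -- ν`. It is paired with `Im h₁ × ν`, whose squared norm is `|Im h₁|²` by Lagrange's identity.
      have hs : ‖h₁.im‖⁻¹ * ‖h₁.im‖ ^ 2 * (c x * μ y - c y * μ x) = 0 := by
        rw [hnsq]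
        linear_combination (h₁.imI * ν.imJ - h₁.imJ * ν.imI) * (b3 - c3) / 2 +
          (h₁.imJ * ν.imK - h₁.imK * ν.imJ) * (b1 - c1) / 2 +
          (h₁.imK * ν.imI - h₁.imI * ν.imK) * (b2 - c2) / 2 +
          ‖h₁.im‖⁻¹ * (c x * μ y - c y * μ x) *
            ((h₁.imI * ν.imI + h₁.imJ * ν.imJ + h₁.imK * ν.imK) * hort -
              (h₁.imI ^ 2 + h₁.imJ ^ 2 + h₁.imK ^ 2) * hνsq)
      exact sub_eq_zero.1 ((mul_eq_zero.1 hs).resolve_left (by positivity))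
    obtain ⟨z, hz⟩ : ∃ z, c z ≠ 0 := by
      by_contra! h
      exact hc (LinearMap.ext h)
    obtain ⟨w, hw⟩ : ∃ w, μ w ≠ 0 := by
      by_contra! h
      exact hμ0 (LinearMap.ext h)
    ext x
    rw [LinearMap.mem_ker, LinearMap.mem_ker]
    constructor
    · intro h
      have := hprod x w
      rw [h, mul_zero] at this
      exact (mul_eq_zero.1 this).resolve_right hw
    · intro h
      have := hprod z x
      rw [h, zero_mul] at this
      exact (mul_eq_zero.1 this).resolve_left hz
  · rintro ⟨-, -, r, c, μ, ν, hν0, hν1, hν2, h3, h4, hk⟩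
    have hprod := mul_eq_mul_of_ker_eq hk
    refine ⟨fun x => ⟨by simp [h4, hν0], by rw [h4, inner_smul_right, hν2, mul_zero], ?_⟩,
      fun x y => ?_, fun x y => ?_⟩
    · rw [h3]
      simp only [ImParallel, Quaternion.imI_add, Quaternion.imJ_add, Quaternion.imK_add,
        Quaternion.imI_coe, Quaternion.imJ_coe, Quaternion.imK_coe, Quaternion.imI_smul,
        Quaternion.imJ_smul, Quaternion.imK_smul, Quaternion.imI_im, Quaternion.imJ_im,
        Quaternion.imK_im, smul_eq_mul, zero_add]
      refine ⟨?_, ?_, ?_⟩ <;> ring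
    all_goals
      have hxy := hprod x y
      rw [h3, h3, h4, h4]
      simp only [ImParallel, Quaternion.imI_add, Quaternion.imJ_add, Quaternion.imK_add,
        Quaternion.imI_sub, Quaternion.imJ_sub, Quaternion.imK_sub,
        Quaternion.imI_coe, Quaternion.imJ_coe, Quaternion.imK_coe, Quaternion.imI_smul,
        Quaternion.imJ_smul, Quaternion.imK_smul, Quaternion.imI_im, Quaternion.imJ_im,
        Quaternion.imK_im, smul_eq_mul, zero_add]
      generalize ‖h₁.im‖⁻¹ = s
    · refine ⟨?_, ?_, ?_⟩
      · linear_combination s * (h₁.imI * ν.imJ - h₁.imJ * ν.imI) * hxy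
      · linear_combination s * (h₁.imJ * ν.imK - h₁.imK * ν.imJ) * hxy
      · linear_combination s * (h₁.imK * ν.imI - h₁.imI * ν.imK) * hxy
    · refine ⟨?_, ?_, ?_⟩
      · linear_combination -s * (h₁.imI * ν.imJ - h₁.imJ * ν.imI) * hxy
      · linear_combination -s * (h₁.imJ * ν.imK - h₁.imK * ν.imJ) * hxy
      · linear_combination -s * (h₁.imK * ν.imI - h₁.imI * ν.imK) * hxy

theorem twistedCommute_and_imParallel_iff {ε : ℝ} (hε : ε = 1 ∨ ε = -1) {h₁ : ℍ[ℝ]}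
    (h₃ h₄ : E →ₗ[ℝ] ℍ[ℝ]) :
    (h₁ ≠ 0 ∧ (∀ x, TwistedCommute ε h₁ (h₃ x) (h₄ x)) ∧
      (∀ x y, ImParallel (h₃ x + h₄ x) (h₃ y + h₄ y)) ∧
      ∀ x y, ImParallel (h₃ x - h₄ x) (h₃ y - h₄ y)) ↔
    FirstCase ε h₁ h₃ h₄ ∨ SecondCase h₁ h₃ h₄ := by
  by_cases hr : h₁.re = 0
  · have hF : ¬FirstCase ε h₁ h₃ h₄ := fun h => h.1 hr
    by_cases hi : h₁.im = 0
    · have hS : ¬SecondCase h₁ h₃ h₄ := fun h => h.2.1 hi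
      have h0 : h₁ = 0 := by rw [← Quaternion.re_add_im h₁, hr, hi]; simp
      exact iff_of_false (fun h => h.1 h0) (by tauto)
    · have h0 : h₁ ≠ 0 := by rintro rfl; exact hi rfl
      rw [secondCase_iff hε hr hi]
      simp [hF, h0]
  · have hS : ¬SecondCase h₁ h₃ h₄ := fun h => hr h.1
    have h0 : h₁ ≠ 0 := by rintro rfl; exact hr rfl
    rw [firstCase_iff hε hr]
    simp [hS, h0]

end Quaternions


/-! ### Operators as quaternionic combinations of `1`, `y`, `ω`, `yω` -/

section CliffordTriple

variable {E : Type*} [NormedAddCommGroup E] [InnerProductSpace ℝ E]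
  {R : Type*} [Ring R] [Algebra ℝ R]

/-- Clifford multiplication `c`, a volume element `ω`, and an identification `κ` of the quaternions
with the commutant of Clifford multiplication. -/
structure IsCliffordTriple (c : E →ₗ[ℝ] R) (ω : R) (κ : ℍ[ℝ] →ₐ[ℝ] R) : Prop where
  mul_add_mul : ∀ x y, c x * c y + c y * c x = (2 * inner ℝ x y : ℝ) • 1
  omega_mul : ∀ x, ω * c x = -(c x * ω)
  omega_sq : ω * ω = 1
  mul_quat : ∀ x h, c x * κ h = κ h * c x
  omega_mul_quat : ∀ h, ω * κ h = κ h * ω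
  inj : Function.Injective κ
  exists_quat : ∀ A, (∀ x, c x * A = A * c x) → ∃ h, κ h = A

namespace IsCliffordTriple

variable {c : E →ₗ[ℝ] R} {ω : R} {κ : ℍ[ℝ] →ₐ[ℝ] R}

section

variable (T : IsCliffordTriple c ω κ)
include T

lemma omega_mul' (x : E) (X : R) : ω * (c x * X) = -(c x * (ω * X)) := by
  rw [← mul_assoc, T.omega_mul, neg_mul, mul_assoc]

lemma mul_quat' (x : E) (h : ℍ[ℝ]) (X : R) : c x * (κ h * X) = κ h * (c x * X) := by
  rw [← mul_assoc, T.mul_quat, mul_assoc]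

lemma omega_mul_quat' (h : ℍ[ℝ]) (X : R) : ω * (κ h * X) = κ h * (ω * X) := by
  rw [← mul_assoc, T.omega_mul_quat, mul_assoc]

lemma mul_self (y : E) : c y * c y = (inner ℝ y y : ℝ) • 1 := by
  have := T.mul_add_mul y y
  rw [← two_smul ℝ, mul_smul] at this
  exact smul_right_injective R (two_ne_zero (α := ℝ)) this

lemma mul_self_of_norm_eq_one {y : E} (hy : ‖y‖ = 1) : c y * c y = 1 := by
  rw [T.mul_self, real_inner_self_eq_norm_sq, hy]; simp

lemma mul_of_inner_eq_zero {z y : E} (h : inner ℝ z y = (0 : ℝ)) : c z * c y = -(c y * c z) := by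
  rw [eq_neg_iff_add_eq_zero, T.mul_add_mul, h]; simp

/-- The elements `1` and `ω` are independent over the quaternions. -/
lemma eq_zero_of_add_omega {y : E} (hy : ‖y‖ = 1) {a b : ℍ[ℝ]} (h : κ a + κ b * ω = 0) :
    a = 0 ∧ b = 0 := by
  have hyy := T.mul_self_of_norm_eq_one hy
  -- Conjugation by `c y` fixes `κ a` and changes the sign of `κ b * ω`.
  have h1 : κ a - κ b * ω = 0 := by
    have : c y * (κ a + κ b * ω) * c y = 0 := by rw [h]; simp
    rw [← this]
    simp only [mul_add, add_mul, mul_assoc, T.mul_quat', T.omega_mul, mul_neg]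
    rw [← mul_assoc (c y) (c y), hyy, mul_one, one_mul]
    abel
  have ha : κ a = 0 := by
    have : (2 : ℝ) • κ a = 0 := by
      rw [two_smul]
      calc κ a + κ a = (κ a + κ b * ω) + (κ a - κ b * ω) := by abel
        _ = 0 := by rw [h, h1, add_zero]
    exact (smul_eq_zero.1 this).resolve_left two_ne_zero
  have hb : κ b = 0 := by
    rw [ha, zero_add] at h
    calc κ b = κ b * ω * ω := by rw [mul_assoc, T.omega_sq, mul_one]
      _ = 0 := by rw [h, zero_mul]
  exact ⟨T.inj (by rw [ha, map_zero]), T.inj (by rw [hb, map_zero])⟩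

/-- The elements `1`, `y`, `ω`, `y ω` are independent over the quaternions. -/
lemma eq_zero_of_sum {y : E} (hy : ‖y‖ = 1) (x : E) {a b d f : ℍ[ℝ]}
    (h : κ a + κ d * ω + (κ b * c x + κ f * c x * ω) = 0) :
    (a = 0 ∧ d = 0) ∧ (‖x‖ = 1 → b = 0 ∧ f = 0) := by
  -- Conjugation by `ω` separates the terms without `c x` from those with it.
  have h1 : κ a + κ d * ω - (κ b * c x + κ f * c x * ω) = 0 := by
    have : ω * (κ a + κ d * ω + (κ b * c x + κ f * c x * ω)) * ω = 0 := by rw [h]; simp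
    rw [← this]
    simp only [mul_add, add_mul, mul_assoc, T.omega_mul_quat', T.omega_mul', T.omega_sq, mul_neg,
      neg_mul, mul_one]
    abel
  have heven : κ a + κ d * ω = 0 := by
    have : (2 : ℝ) • (κ a + κ d * ω) = 0 := by
      rw [two_smul]
      calc _ = (κ a + κ d * ω + (κ b * c x + κ f * c x * ω)) +
            (κ a + κ d * ω - (κ b * c x + κ f * c x * ω)) := by abel
        _ = 0 := by rw [h, h1, add_zero]
    exact (smul_eq_zero.1 this).resolve_left two_ne_zero
  refine ⟨T.eq_zero_of_add_omega hy heven, fun hx => ?_⟩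
  rw [heven, zero_add] at h
  have h2 : κ b + κ (-f) * ω = 0 := by
    have h3 : (κ b * c x + κ f * c x * ω) * c x = 0 := by rw [h, zero_mul]
    simp only [add_mul, mul_assoc, T.omega_mul, mul_neg] at h3
    rw [← mul_assoc (c x) (c x), T.mul_self_of_norm_eq_one hx, mul_one, one_mul] at h3
    rw [map_neg, neg_mul]
    exact h3
  obtain ⟨hb, hf⟩ := T.eq_zero_of_add_omega hy h2
  exact ⟨hb, neg_eq_zero.1 hf⟩

lemma exists_quat_of_orthogonal {y : E} (hy : ‖y‖ = 1) {A : R} (h1 : c y * A = A * c y)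
    (h2 : ∀ z, inner ℝ z y = (0 : ℝ) → c z * A = A * c z) : ∃ h, κ h = A := by
  refine T.exists_quat A fun x => ?_
  have hz := h2 (x - (inner ℝ x y : ℝ) • y) (by
    rw [inner_sub_left, inner_smul_left, real_inner_self_eq_norm_sq, hy]; simp)
  rw [map_sub, map_smul, sub_mul, mul_sub, smul_mul_assoc, mul_smul_comm, h1] at hz
  exact sub_left_injective hz

/-- An element that intertwines up to signs with a unit vector and with its orthogonal complement
is the product of a quaternion and of one of `1`, `y`, `ω`, `y ω`. -/
lemma exists_quat_mul {y : E} (hy : ‖y‖ = 1) {A u : R} {σ τ : ℝ}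
    (hu : u * u = 1 ∨ u * u = -1) (hσ : σ * σ = 1) (hτ : τ * τ = 1)
    (h1 : c y * A = σ • (A * c y))
    (h2 : ∀ z, inner ℝ z y = (0 : ℝ) → c z * A = τ • (A * c z))
    (u1 : c y * u = σ • (u * c y))
    (u2 : ∀ z, inner ℝ z y = (0 : ℝ) → c z * u = τ • (u * c z)) : ∃ h, κ h * u = A := by
  -- In `A * u` the signs of `A` and `u` cancel, so it commutes with all vectors; `A` is recovered
  -- from `u * u = ±1`.
  obtain ⟨h, hh⟩ := T.exists_quat_of_orthogonal hy (A := A * u)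
    (by rw [← mul_assoc, h1, smul_mul_assoc, mul_assoc, u1, mul_smul_comm, smul_smul, hσ,
      one_smul, mul_assoc])
    (fun z hz => by rw [← mul_assoc, h2 z hz, smul_mul_assoc, mul_assoc, u2 z hz, mul_smul_comm,
      smul_smul, hτ, one_smul, mul_assoc])
  rcases hu with hu | hu
  · exact ⟨h, by rw [hh, mul_assoc, hu, mul_one]⟩
  · exact ⟨-h, by rw [map_neg, hh, neg_mul, mul_assoc, hu, mul_neg_one, neg_neg]⟩

/-- Moving a vector `z ⊥ y` across exchanges `a` and `d`, so `a + d` commutes with `z` and `a - d`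
anticommutes with it. Splitting both under conjugation by `y` gives parts with definite signs, and
the sign patterns for `(y, z)` are realised by `1` as `(+, +)`, `yω` as `(-, +)`, `y` as `(+, -)`
and `ω` as `(-, -)`. -/
lemma exists_decomposition {y : E} (hy : ‖y‖ = 1) {a d Q : R}
    (hyQ : c y * d - a * c y = Q)
    (hz : ∀ z, inner ℝ z y = (0 : ℝ) → c z * d = a * c z) :
    ∃ h₁ h₂ h₃ h₄ : ℍ[ℝ], Q = κ h₁ + κ h₂ * ω ∧
      (2 : ℝ) • a = κ h₃ - κ h₁ * c y + κ h₂ * c y * ω - κ h₄ * ω ∧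
      (2 : ℝ) • d = κ h₃ + κ h₁ * c y + κ h₂ * c y * ω + κ h₄ * ω := by
  have hyy := T.mul_self_of_norm_eq_one hy
  have hyy' : ∀ X, c y * (c y * X) = X := fun X => by rw [← mul_assoc, hyy, one_mul]
  have hz' : ∀ z, inner ℝ z y = (0 : ℝ) → d * c z = c z * a := fun z h => by
    by_cases h0 : z = 0
    · simp [h0]
    · refine smul_right_injective R (inner_self_ne_zero (𝕜 := ℝ).2 h0) ?_
      have e1 : c z * c z * (d * c z) = c z * a * (c z * c z) := by
        rw [mul_assoc, ← mul_assoc (c z) d, hz z h]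
        simp only [mul_assoc]
      rw [T.mul_self z] at e1
      simpa using e1
  have hzy : ∀ z, inner ℝ z y = (0 : ℝ) → ∀ X, c z * (c y * X) = -(c y * (c z * X)) :=
    fun z h X => by rw [← mul_assoc, T.mul_of_inner_eq_zero h, neg_mul, mul_assoc]
  have hzd : ∀ z, inner ℝ z y = (0 : ℝ) → ∀ X, c z * (d * X) = a * (c z * X) :=
    fun z h X => by rw [← mul_assoc, hz z h, mul_assoc]
  have hza : ∀ z, inner ℝ z y = (0 : ℝ) → ∀ X, c z * (a * X) = d * (c z * X) :=
    fun z h X => by rw [← mul_assoc, ← hz' z h, mul_assoc]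
  obtain ⟨k₃, hk₃⟩ := T.exists_quat_mul (u := 1) (σ := 1) (τ := 1)
    (A := (a + d) + c y * (a + d) * c y) hy (by simp) (by simp) (by simp)
    (by simp only [mul_add, add_mul, mul_assoc, hyy', hyy, mul_one, one_smul]; abel)
    (fun z h => by
      simp only [mul_add, add_mul, mul_assoc, hzy z h, hza z h, hzd z h, hz z h,
        T.mul_of_inner_eq_zero h, mul_neg, neg_neg, one_smul, hz' z h]
      abel) (by simp) (by simp)
  obtain ⟨k₂, hk₂⟩ := T.exists_quat_mul (u := c y * ω) (σ := -1) (τ := 1)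
    (A := (a + d) - c y * (a + d) * c y) hy
    (by
      right
      rw [mul_assoc, T.omega_mul', T.omega_sq, mul_neg, mul_one, hyy]) (by simp) (by simp)
    (by
      simp only [mul_add, add_mul, mul_sub, sub_mul, mul_assoc, hyy', hyy, mul_one, neg_smul,
        one_smul]
      abel)
    (fun z h => by
      simp only [mul_add, add_mul, mul_sub, sub_mul, mul_assoc, hzy z h, hza z h, hzd z h, hz z h,
        T.mul_of_inner_eq_zero h, mul_neg, neg_neg, one_smul, hz' z h]
      abel)
    (by simp [mul_assoc, T.omega_mul])
    (fun z h => by simp [mul_assoc, T.omega_mul, hzy z h])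
  obtain ⟨k₁, hk₁⟩ := T.exists_quat_mul (u := c y) (σ := 1) (τ := -1)
    (A := (a - d) + c y * (a - d) * c y) hy (Or.inl hyy) (by simp) (by simp)
    (by
      simp only [mul_add, add_mul, mul_sub, sub_mul, mul_assoc, hyy', hyy, mul_one, one_smul]
      abel)
    (fun z h => by
      simp only [mul_add, add_mul, mul_sub, sub_mul, mul_assoc, hzy z h, hza z h, hzd z h, hz z h,
        T.mul_of_inner_eq_zero h, mul_neg, neg_neg, neg_smul, one_smul, hz' z h]
      abel)
    (by simp)
    (fun z h => by simp [T.mul_of_inner_eq_zero h])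
  obtain ⟨k₄, hk₄⟩ := T.exists_quat_mul (u := ω) (σ := -1) (τ := -1)
    (A := (a - d) - c y * (a - d) * c y) hy (Or.inl T.omega_sq) (by simp) (by simp)
    (by
      simp only [mul_sub, sub_mul, mul_assoc, hyy', hyy, mul_one, neg_smul,
        one_smul]
      abel)
    (fun z h => by
      simp only [mul_sub, sub_mul, mul_assoc, hzy z h, hza z h, hzd z h, hz z h,
        T.mul_of_inner_eq_zero h, mul_neg, neg_neg, neg_smul, one_smul, hz' z h]
      abel)
    (by simp [T.omega_mul])
    (fun z h => by simp [T.omega_mul])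
  have hs : (2 : ℝ) • (a + d) = κ k₃ + κ k₂ * (c y * ω) := by
    rw [← mul_one (κ k₃), hk₃, hk₂, two_smul]; abel
  have hr : (2 : ℝ) • (a - d) = κ k₁ * c y + κ k₄ * ω := by
    rw [hk₁, hk₄, two_smul]; abel
  have ha : (2 : ℝ) • a = (1 / 2 : ℝ) • (κ k₃ + κ k₂ * (c y * ω) + (κ k₁ * c y + κ k₄ * ω)) := by
    rw [← hs, ← hr]; module
  have hd : (2 : ℝ) • d = (1 / 2 : ℝ) • (κ k₃ + κ k₂ * (c y * ω) - (κ k₁ * c y + κ k₄ * ω)) := by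
    rw [← hs, ← hr]; module
  -- The four parts were formed without a factor `1 / 2`; the signs of `k₁` and `k₄` are those with
  -- which `y` and `ω` enter the prescribed form of `a`.
  refine ⟨-(1 / 2 : ℝ) • k₁, (1 / 2 : ℝ) • k₂, (1 / 2 : ℝ) • k₃, -(1 / 2 : ℝ) • k₄, ?_, ?_, ?_⟩
  · refine smul_right_injective R (two_ne_zero (α := ℝ)) ?_
    change (2 : ℝ) • Q = (2 : ℝ) • _
    rw [← hyQ, smul_sub, ← mul_smul_comm, ← smul_mul_assoc, ha, hd]
    simp only [map_smul, mul_smul_comm, smul_mul_assoc, mul_add, add_mul, mul_sub, mul_assoc,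
      T.mul_quat, T.mul_quat', T.omega_mul, hyy, hyy', mul_neg, mul_one, smul_add, smul_sub]
    module
  · rw [ha]
    simp only [map_smul, smul_mul_assoc, mul_assoc]
    module
  · rw [hd]
    simp only [map_smul, smul_mul_assoc, mul_assoc]
    module

end

end IsCliffordTriple

end CliffordTriple


/-! ### Classification of the diagonal blocks -/

section Classification

variable {E : Type*} [NormedAddCommGroup E] [InnerProductSpace ℝ E]
  {R : Type*} [Ring R] [Algebra ℝ R]
  {c : E →ₗ[ℝ] R} {ω : R} {κ : ℍ[ℝ] →ₐ[ℝ] R}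

/-- Twice the maps `a` and `d` are of the form `h₃ - h₁ x + h₂ x ω - h₄ ω` and
`h₃ + h₁ x + h₂ x ω + h₄ ω`. -/
structure IsDiagonalPair (c : E →ₗ[ℝ] R) (ω : R) (κ : ℍ[ℝ] →ₐ[ℝ] R) (h₁ h₂ : ℍ[ℝ])
    (h₃ h₄ : E →ₗ[ℝ] ℍ[ℝ]) (a d : E →ₗ[ℝ] R) : Prop where
  left : ∀ x, a x = (1 / 2 : ℝ) •
    (κ (h₃ x) - κ h₁ * c x + κ h₂ * c x * ω - κ (h₄ x) * ω)
  right : ∀ x, d x = (1 / 2 : ℝ) •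
    (κ (h₃ x) + κ h₁ * c x + κ h₂ * c x * ω + κ (h₄ x) * ω)

namespace IsCliffordTriple

variable (T : IsCliffordTriple c ω κ)
include T

/-- The decompositions at different unit vectors share `h₁` and `h₂`, because `Q = h₁ + h₂ ω`
determines them. Linearity of `h₃` and `h₄` comes from a left inverse of the injective map `(k₃, k₄)
↦ k₃ - k₄ ω`. -/
lemma exists_isDiagonalPair {y₀ : E} (hy₀ : ‖y₀‖ = 1) {a d : E →ₗ[ℝ] R} {Q : R}
    (H : ∀ z y, c z * d y - a y * c z = (inner ℝ z y : ℝ) • Q) :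
    ∃ (h₁ h₂ : ℍ[ℝ]) (h₃ h₄ : E →ₗ[ℝ] ℍ[ℝ]), Q = κ h₁ + κ h₂ * ω ∧
      IsDiagonalPair c ω κ h₁ h₂ h₃ h₄ a d := by
  have hdec : ∀ y : E, ‖y‖ = 1 → _ := fun y hy => T.exists_decomposition hy (a := a y) (d := d y)
    (Q := Q) (by rw [H, real_inner_self_eq_norm_sq, hy]; simp)
    (fun z hz => by rw [← sub_eq_zero, H, hz, zero_smul])
  obtain ⟨h₁, h₂, -, -, hQ, -, -⟩ := hdec y₀ hy₀
  have hunit : ∀ y : E, ‖y‖ = 1 → ∃ k₃ k₄ : ℍ[ℝ],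
      (2 : ℝ) • a y = κ k₃ - κ h₁ * c y + κ h₂ * c y * ω - κ k₄ * ω ∧
      (2 : ℝ) • d y = κ k₃ + κ h₁ * c y + κ h₂ * c y * ω + κ k₄ * ω := by
    intro y hy
    obtain ⟨k₁, k₂, k₃, k₄, hQ', ha, hd⟩ := hdec y hy
    obtain ⟨e₁, e₂⟩ := T.eq_zero_of_add_omega hy₀ (a := h₁ - k₁) (b := h₂ - k₂) (by
      rw [map_sub, map_sub, sub_mul]
      calc _ = (κ h₁ + κ h₂ * ω) - (κ k₁ + κ k₂ * ω) := by abel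
        _ = 0 := by rw [← hQ, ← hQ', sub_self])
    rw [sub_eq_zero] at e₁ e₂
    subst e₁ e₂
    exact ⟨k₃, k₄, ha, hd⟩
  have hall : ∀ y : E, ∃ k₃ k₄ : ℍ[ℝ],
      (2 : ℝ) • a y = κ k₃ - κ h₁ * c y + κ h₂ * c y * ω - κ k₄ * ω ∧
      (2 : ℝ) • d y = κ k₃ + κ h₁ * c y + κ h₂ * c y * ω + κ k₄ * ω := by
    intro y
    by_cases hy : y = 0
    · exact ⟨0, 0, by simp [hy], by simp [hy]⟩
    · have hn : ‖y‖ ≠ 0 := norm_ne_zero_iff.2 hy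
      obtain ⟨k₃, k₄, ha, hd⟩ := hunit (‖y‖⁻¹ • y) (by
        rw [norm_smul, norm_inv, norm_norm, inv_mul_cancel₀ hn])
      have hyy : y = ‖y‖ • (‖y‖⁻¹ • y) := by rw [smul_smul, mul_inv_cancel₀ hn, one_smul]
      refine ⟨‖y‖ • k₃, ‖y‖ • k₄, ?_, ?_⟩
      · conv_lhs => rw [hyy, map_smul, smul_comm, ha]
        conv_rhs => rw [show c y = ‖y‖ • c (‖y‖⁻¹ • y) by rw [← map_smul, ← hyy]]
        simp only [map_smul, smul_mul_assoc, mul_smul_comm]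
        module
      · conv_lhs => rw [hyy, map_smul, smul_comm, hd]
        conv_rhs => rw [show c y = ‖y‖ • c (‖y‖⁻¹ • y) by rw [← map_smul, ← hyy]]
        simp only [map_smul, smul_mul_assoc, mul_smul_comm]
        module
  let f : ℍ[ℝ] × ℍ[ℝ] →ₗ[ℝ] R := κ.toLinearMap.coprod
    (-(LinearMap.mulRight ℝ ω ∘ₗ κ.toLinearMap))
  have hf : ∀ k₃ k₄, f (k₃, k₄) = κ k₃ - κ k₄ * ω := fun k₃ k₄ => by simp [f, sub_eq_add_neg]
  obtain ⟨g, hg⟩ := LinearMap.exists_leftInverse_of_injective f (by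
    rw [LinearMap.ker_eq_bot']
    rintro ⟨k₃, k₄⟩ h
    rw [hf, sub_eq_add_neg, ← neg_mul, ← map_neg] at h
    obtain ⟨e, e'⟩ := T.eq_zero_of_add_omega hy₀ h
    rw [e, neg_eq_zero.1 e']
    rfl)
  let G : E →ₗ[ℝ] ℍ[ℝ] × ℍ[ℝ] := g ∘ₗ ((2 : ℝ) • a + LinearMap.mulLeft ℝ (κ h₁) ∘ₗ c -
    LinearMap.mulRight ℝ ω ∘ₗ LinearMap.mulLeft ℝ (κ h₂) ∘ₗ c)
  have hG : ∀ y k₃ k₄, (2 : ℝ) • a y = κ k₃ - κ h₁ * c y + κ h₂ * c y * ω - κ k₄ * ω →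
      G y = (k₃, k₄) := by
    intro y k₃ k₄ h
    have h1 : G y = g ((2 : ℝ) • a y + κ h₁ * c y - κ h₂ * c y * ω) := rfl
    have h2 : κ k₃ - κ h₁ * c y + κ h₂ * c y * ω - κ k₄ * ω + κ h₁ * c y - κ h₂ * c y * ω =
        f (k₃, k₄) := by rw [hf]; abel
    rw [h1, h, h2]
    exact LinearMap.congr_fun hg _
  refine ⟨h₁, h₂, LinearMap.fst ℝ _ _ ∘ₗ G, LinearMap.snd ℝ _ _ ∘ₗ G, hQ, ?_, ?_⟩ <;>
  · intro x
    obtain ⟨k₃, k₄, ha, hd⟩ := hall x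
    have := hG x k₃ k₄ ha
    simp only [LinearMap.comp_apply, this, LinearMap.fst_apply, LinearMap.snd_apply, ← ha, ← hd]
    module

variable {h₁ h₂ : ℍ[ℝ]} {h₃ h₄ : E →ₗ[ℝ] ℍ[ℝ]} {a d : E →ₗ[ℝ] R}

lemma mul_sub_mul_of_isDiagonalPair (hP : IsDiagonalPair c ω κ h₁ h₂ h₃ h₄ a d) (z y : E) :
    c z * d y - a y * c z = (inner ℝ z y : ℝ) • (κ h₁ + κ h₂ * ω) := by
  have h1 : (inner ℝ z y : ℝ) • (κ h₁ + κ h₂ * ω) =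
      (1 / 2 : ℝ) • (κ h₁ * (c z * c y + c y * c z) + κ h₂ * ((c z * c y + c y * c z) * ω)) := by
    rw [T.mul_add_mul]
    simp only [mul_smul_comm, smul_mul_assoc, mul_one, one_mul]
    module
  rw [h1, hP.left, hP.right]
  simp only [mul_smul_comm, smul_mul_assoc, mul_add, add_mul, sub_mul, mul_assoc, T.mul_quat',
    T.mul_quat, T.omega_mul, mul_neg]
  module

/-- The result is sorted by `1`, `ω`, `y`, `yω`, so that `eq_zero_of_sum` can read off the vanishing
of each coefficient. -/
lemma two_smul_mul_sub_mul (hP : IsDiagonalPair c ω κ h₁ h₂ h₃ h₄ a d) (y : E) :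
    (2 : ℝ) • ((κ h₁ + κ h₂ * ω) * d y - a y * (κ h₁ + κ h₂ * ω)) =
      κ (h₁ * h₃ y + h₂ * h₄ y - h₃ y * h₁ + h₄ y * h₂) +
      κ (h₁ * h₄ y + h₂ * h₃ y - h₃ y * h₂ + h₄ y * h₁) * ω +
      (κ ((2 : ℝ) • (h₁ * h₁ - h₂ * h₂)) * c y + κ ((2 : ℝ) • (h₁ * h₂ - h₂ * h₁)) * c y * ω) := by
  rw [hP.left, hP.right]
  simp only [mul_smul_comm, smul_mul_assoc, mul_add, add_mul, sub_mul, mul_assoc,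
    T.mul_quat', T.mul_quat, T.omega_mul, T.omega_mul', T.omega_mul_quat, T.omega_mul_quat',
    T.omega_sq, mul_neg, map_add, map_sub, map_mul, map_smul, mul_one]
  module

/-- Nothing quadratic in `h₁` survives, since `x (1 - εω) y (1 - εω) = x y (1 + εω) (1 - εω) = 0`.
The vectors that remain are multiplied by the expressions in `TwistedCommute`. -/
lemma commutator_left {ε : ℝ} (hε : ε = 1 ∨ ε = -1)
    (hP : IsDiagonalPair c ω κ h₁ (ε • h₁) h₃ h₄ a d) (x y : E) :
    (4 : ℝ) • (a x * a y - a y * a x) =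
      κ (h₃ x * h₃ y - h₃ y * h₃ x + (h₄ x * h₄ y - h₄ y * h₄ x)) -
      κ (h₃ x * h₄ y - h₄ y * h₃ x + (h₄ x * h₃ y - h₃ y * h₄ x)) * ω +
      (κ (h₁ * h₃ x - h₃ x * h₁ + ε • (h₁ * h₄ x + h₄ x * h₁)) * c y -
        κ (h₁ * h₃ y - h₃ y * h₁ + ε • (h₁ * h₄ y + h₄ y * h₁)) * c x) * (1 - ε • ω) := by
  rw [hP.left, hP.left]
  rcases hε with rfl | rfl <;>
  simp only [mul_smul_comm, smul_mul_assoc, mul_add, add_mul, sub_mul, mul_sub, mul_assoc,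
    T.mul_quat', T.mul_quat, T.omega_mul, T.omega_mul', T.omega_mul_quat, T.omega_mul_quat',
    T.omega_sq, mul_neg, map_add, map_sub, map_mul, map_smul, mul_one] <;>
  module

lemma commutator_right {ε : ℝ} (hε : ε = 1 ∨ ε = -1)
    (hP : IsDiagonalPair c ω κ h₁ (ε • h₁) h₃ h₄ a d) (x y : E) :
    (4 : ℝ) • (d x * d y - d y * d x) =
      κ (h₃ x * h₃ y - h₃ y * h₃ x + (h₄ x * h₄ y - h₄ y * h₄ x)) +
      κ (h₃ x * h₄ y - h₄ y * h₃ x + (h₄ x * h₃ y - h₃ y * h₄ x)) * ω -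
      (κ (h₁ * h₃ x - h₃ x * h₁ + ε • (h₁ * h₄ x + h₄ x * h₁)) * c y -
        κ (h₁ * h₃ y - h₃ y * h₁ + ε • (h₁ * h₄ y + h₄ y * h₁)) * c x) * (1 + ε • ω) := by
  rw [hP.right, hP.right]
  rcases hε with rfl | rfl <;>
  simp only [mul_smul_comm, smul_mul_assoc, mul_add, add_mul, sub_mul, mul_assoc,
    T.mul_quat', T.mul_quat, T.omega_mul, T.omega_mul', T.omega_mul_quat, T.omega_mul_quat',
    T.omega_sq, mul_neg, map_add, map_sub, map_mul, map_smul, mul_one] <;>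
  module

end IsCliffordTriple

end Classification


section Classification

variable {E : Type*} [NormedAddCommGroup E] [InnerProductSpace ℝ E]
  {R : Type*} [Ring R] [Algebra ℝ R]
  {c : E →ₗ[ℝ] R} {ω : R} {κ : ℍ[ℝ] →ₐ[ℝ] R}

theorem IsCliffordTriple.classification (T : IsCliffordTriple c ω κ) {y₀ : E} (hy₀ : ‖y₀‖ = 1)
    (a d : E →ₗ[ℝ] R) (Q : R) :
    ((∀ z y, c z * d y - a y * c z = (inner ℝ z y : ℝ) • Q) ∧ (∀ y, Q * d y = a y * Q) ∧
      (∀ x y, a x * a y = a y * a x) ∧ (∀ x y, d x * d y = d y * d x) ∧ Q ≠ 0) ↔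
    ∃ (ε : ℝ) (h₁ : ℍ[ℝ]) (h₃ h₄ : E →ₗ[ℝ] ℍ[ℝ]), (ε = 1 ∨ ε = -1) ∧
      (FirstCase ε h₁ h₃ h₄ ∨ SecondCase h₁ h₃ h₄) ∧ Q = κ h₁ * (1 + ε • ω) ∧
      IsDiagonalPair c ω κ h₁ (ε • h₁) h₃ h₄ a d := by
  have hQform : ∀ (ε : ℝ) (h₁ : ℍ[ℝ]), κ h₁ + κ (ε • h₁) * ω = κ h₁ * (1 + ε • ω) := fun ε h₁ => by
    rw [map_smul, mul_add, mul_one, smul_mul_assoc, mul_smul_comm]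
  constructor
  -- The commutation of the `d`'s is discarded: it leads to the same quaternionic equations as that
  -- of the `a`'s.
  · rintro ⟨H, hQ, ha, -, hQ0⟩
    obtain ⟨h₁, h₂, h₃, h₄, rfl, hP⟩ := T.exists_isDiagonalPair hy₀ H
    have hsum : ∀ y, _ := fun y => T.eq_zero_of_sum hy₀ y
      ((T.two_smul_mul_sub_mul hP y).symm.trans (by rw [hQ, sub_self, smul_zero]))
    obtain ⟨ε, hε, rfl⟩ : ∃ ε : ℝ, (ε = 1 ∨ ε = -1) ∧ h₂ = ε • h₁ := by
      obtain ⟨e₁, e₂⟩ := (hsum y₀).2 hy₀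
      have e₁ := (smul_eq_zero.1 e₁).resolve_left two_ne_zero
      have e₂ := (smul_eq_zero.1 e₂).resolve_left two_ne_zero
      have : (h₁ - h₂) * (h₁ + h₂) = 0 := by
        calc _ = (h₁ * h₁ - h₂ * h₂) + (h₁ * h₂ - h₂ * h₁) := by noncomm_ring
          _ = 0 := by rw [e₁, e₂, add_zero]
      rcases mul_eq_zero.1 this with h | h
      · exact ⟨1, Or.inl rfl, by rw [one_smul]; exact (sub_eq_zero.1 h).symm⟩
      · exact ⟨-1, Or.inr rfl, by rw [neg_one_smul]; exact eq_neg_of_add_eq_zero_right h⟩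
    have hA : ∀ x, TwistedCommute ε h₁ (h₃ x) (h₄ x) := fun x => by
      rw [TwistedCommute, ← (hsum x).1.1]
      simp only [smul_mul_assoc, mul_smul_comm]
      module
    have hh₁ : h₁ ≠ 0 := by
      rintro rfl
      exact hQ0 (by simp)
    have hcomm : ∀ x y, h₃ x * h₃ y - h₃ y * h₃ x + (h₄ x * h₄ y - h₄ y * h₄ x) = 0 ∧
        h₃ x * h₄ y - h₄ y * h₃ x + (h₄ x * h₃ y - h₃ y * h₄ x) = 0 := fun x y => by
      have h := T.commutator_left hε hP x y
      have hx : h₁ * h₃ x - h₃ x * h₁ + ε • (h₁ * h₄ x + h₄ x * h₁) = 0 := hA x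
      have hy : h₁ * h₃ y - h₃ y * h₁ + ε • (h₁ * h₄ y + h₄ y * h₁) = 0 := hA y
      rw [hx, hy, ha, sub_self, smul_zero, map_zero, zero_mul, zero_mul, sub_self, zero_mul,
        add_zero, sub_eq_add_neg, ← neg_mul, ← map_neg] at h
      obtain ⟨e₁, e₂⟩ := T.eq_zero_of_add_omega hy₀ h.symm
      exact ⟨e₁, neg_eq_zero.1 e₂⟩
    refine ⟨ε, h₁, h₃, h₄, hε, ?_, hQform ε h₁, hP⟩
    -- The sum and the difference of the two relations in `hcomm` are the commutators of values of
    -- `h₃ + h₄` and of `h₃ - h₄`.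
    refine (twistedCommute_and_imParallel_iff hε h₃ h₄).1 ⟨hh₁, hA, fun x y => ?_, fun x y => ?_⟩ <;>
    rw [← mul_comm_iff_imParallel, ← sub_eq_zero]
    · obtain ⟨e₁, e₂⟩ := hcomm x y
      rw [← add_zero (0 : ℍ[ℝ])]
      nth_rw 1 [← e₁, ← e₂]
      noncomm_ring
    · obtain ⟨e₁, e₂⟩ := hcomm x y
      rw [← sub_zero (0 : ℍ[ℝ])]
      nth_rw 1 [← e₁, ← e₂]
      noncomm_ring
  · rintro ⟨ε, h₁, h₃, h₄, hε, hcase, rfl, hP⟩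
    obtain ⟨hh₁, hA, hB, hC⟩ := (twistedCommute_and_imParallel_iff hε h₃ h₄).2 hcase
    have hε2 : ε * ε = 1 := by rcases hε with rfl | rfl <;> norm_num
    have hcomm : ∀ x y, h₃ x * h₃ y - h₃ y * h₃ x + (h₄ x * h₄ y - h₄ y * h₄ x) = 0 ∧
        h₃ x * h₄ y - h₄ y * h₃ x + (h₄ x * h₃ y - h₃ y * h₄ x) = 0 := fun x y => by
      have e₁ := sub_eq_zero.2 ((mul_comm_iff_imParallel _ _).2 (hB x y))
      have e₂ := sub_eq_zero.2 ((mul_comm_iff_imParallel _ _).2 (hC x y))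
      have hhalf : ∀ q : ℍ[ℝ], q + q = 0 → q = 0 := fun q hq => by
        rw [← two_smul ℝ] at hq
        exact (smul_eq_zero.1 hq).resolve_left two_ne_zero
      constructor <;> refine hhalf _ ?_
      · rw [← add_zero (0 : ℍ[ℝ])]
        nth_rw 1 [← e₁, ← e₂]
        noncomm_ring
      · rw [← sub_zero (0 : ℍ[ℝ])]
        nth_rw 1 [← e₁, ← e₂]
        noncomm_ring
    refine ⟨fun z y => ?_, fun y => ?_, fun x y => ?_, fun x y => ?_, fun h => ?_⟩
    · rw [← hQform]
      exact T.mul_sub_mul_of_isDiagonalPair hP z y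
    · have h := T.two_smul_mul_sub_mul hP y
      have hy : h₁ * h₃ y - h₃ y * h₁ + ε • (h₁ * h₄ y + h₄ y * h₁) = 0 := hA y
      have f₁ : h₁ * h₃ y + ε • h₁ * h₄ y - h₃ y * h₁ + h₄ y * ε • h₁ = 0 := by
        rw [← hy]
        simp only [smul_mul_assoc, mul_smul_comm]
        module
      have f₂ : h₁ * h₄ y + ε • h₁ * h₃ y - h₃ y * ε • h₁ + h₄ y * h₁ = 0 := by
        rw [← smul_zero ε, ← hy, smul_add, smul_smul, hε2]
        simp only [smul_mul_assoc, mul_smul_comm]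
        module
      have f₃ : h₁ * h₁ - ε • h₁ * ε • h₁ = 0 := by
        rw [smul_mul_smul_comm, hε2, one_smul, sub_self]
      have f₄ : h₁ * ε • h₁ - ε • h₁ * h₁ = 0 := by
        rw [mul_smul_comm, smul_mul_assoc, sub_self]
      rw [f₁, f₂, f₃, f₄] at h
      simp only [smul_zero, map_zero, zero_mul, add_zero] at h
      rw [← hQform]
      exact sub_eq_zero.1 ((smul_eq_zero.1 h).resolve_left two_ne_zero)
    · have h := T.commutator_left hε hP x y
      have hx : h₁ * h₃ x - h₃ x * h₁ + ε • (h₁ * h₄ x + h₄ x * h₁) = 0 := hA x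
      have hy : h₁ * h₃ y - h₃ y * h₁ + ε • (h₁ * h₄ y + h₄ y * h₁) = 0 := hA y
      rw [hx, hy, (hcomm x y).1, (hcomm x y).2] at h
      simp only [map_zero, zero_mul, sub_zero, add_zero] at h
      exact sub_eq_zero.1 ((smul_eq_zero.1 h).resolve_left four_ne_zero)
    · have h := T.commutator_right hε hP x y
      have hx : h₁ * h₃ x - h₃ x * h₁ + ε • (h₁ * h₄ x + h₄ x * h₁) = 0 := hA x
      have hy : h₁ * h₃ y - h₃ y * h₁ + ε • (h₁ * h₄ y + h₄ y * h₁) = 0 := hA y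
      rw [hx, hy, (hcomm x y).1, (hcomm x y).2] at h
      simp only [map_zero, zero_mul, sub_zero, add_zero] at h
      exact sub_eq_zero.1 ((smul_eq_zero.1 h).resolve_left four_ne_zero)
    · rw [← hQform] at h
      exact hh₁ (T.eq_zero_of_add_omega hy₀ h).1

end Classification

/-! ### Calculus of block matrices -/

section Block

variable {S : Type*} [AddCommGroup S] [Module ℝ S]

lemma block_mul (a b c d a' b' c' d' : Module.End ℝ S) :
    block a b c d * block a' b' c' d' =
      block (a * a' + b * c') (a * b' + b * d') (c * a' + d * c') (c * b' + d * d') := by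
  refine LinearMap.ext fun s => ?_
  simp only [Module.End.mul_apply, block_apply, map_add, LinearMap.add_apply]
  refine Prod.ext ?_ ?_ <;> dsimp only <;> abel

lemma block_add (a b c d a' b' c' d' : Module.End ℝ S) :
    block a b c d + block a' b' c' d' = block (a + a') (b + b') (c + c') (d + d') := by
  refine LinearMap.ext fun s => ?_
  simp only [LinearMap.add_apply, block_apply]
  refine Prod.ext ?_ ?_ <;> dsimp only [Prod.fst_add, Prod.snd_add] <;> abel

lemma smul_block (r : ℝ) (a b c d : Module.End ℝ S) :
    r • block a b c d = block (r • a) (r • b) (r • c) (r • d) := by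
  refine LinearMap.ext fun s => ?_
  simp only [LinearMap.smul_apply, block_apply]
  refine Prod.ext ?_ ?_ <;> dsimp only [Prod.smul_fst, Prod.smul_snd] <;> rw [smul_add]

lemma block_sub (a b c d a' b' c' d' : Module.End ℝ S) :
    block a b c d - block a' b' c' d' = block (a - a') (b - b') (c - c') (d - d') := by
  rw [sub_eq_add_neg, ← neg_one_smul ℝ, smul_block, block_add]
  simp [sub_eq_add_neg]

lemma block_inj {a b c d a' b' c' d' : Module.End ℝ S} :
    block a b c d = block a' b' c' d' ↔ a = a' ∧ b = b' ∧ c = c' ∧ d = d' := by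
  constructor
  · intro h
    have h1 : ∀ s, (a s, c s) = (a' s, c' s) := fun s => by
      simpa [block_apply] using LinearMap.congr_fun h (s, 0)
    have h2 : ∀ s, (b s, d s) = (b' s, d' s) := fun s => by
      simpa [block_apply] using LinearMap.congr_fun h (0, s)
    exact ⟨LinearMap.ext fun s => congrArg Prod.fst (h1 s),
      LinearMap.ext fun s => congrArg Prod.fst (h2 s),
      LinearMap.ext fun s => congrArg Prod.snd (h1 s),
      LinearMap.ext fun s => congrArg Prod.snd (h2 s)⟩
  · rintro ⟨rfl, rfl, rfl, rfl⟩
    rfl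

lemma block_zero : block (0 : Module.End ℝ S) 0 0 0 = 0 :=
  LinearMap.ext fun s => by simp [block_apply]

lemma exists_block {V : Type*} [AddCommGroup V] [Module ℝ V]
    (f : V →ₗ[ℝ] Module.End ℝ (S × S)) : ∃ a b c d : V →ₗ[ℝ] Module.End ℝ S,
      ∀ x, f x = block (a x) (b x) (c x) (d x) := by
  let proj (i : S →ₗ[ℝ] S × S) (p : S × S →ₗ[ℝ] S) : V →ₗ[ℝ] Module.End ℝ S :=
    { toFun := fun x => p ∘ₗ f x ∘ₗ i
      map_add' := fun x y => by rw [map_add, LinearMap.add_comp, LinearMap.comp_add]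
      map_smul' := fun r x => by
        rw [map_smul, LinearMap.smul_comp, LinearMap.comp_smul]; rfl }
  refine ⟨proj (.inl ℝ S S) (.fst ℝ S S), proj (.inr ℝ S S) (.fst ℝ S S),
    proj (.inl ℝ S S) (.snd ℝ S S), proj (.inr ℝ S S) (.snd ℝ S S), fun x => ?_⟩
  refine LinearMap.ext fun s => ?_
  have : s = LinearMap.inl ℝ S S s.1 + LinearMap.inr ℝ S S s.2 := by simp
  conv_lhs => rw [this, map_add]
  rfl

end Block

/-! ### The spinor module as a Clifford triple -/

section SpinModule

variable {E : Type*} [NormedAddCommGroup E] [InnerProductSpace ℝ E]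
variable {S : Type*} [AddCommGroup S] [Module ℝ S] [Module (Cl E) S] [IsScalarTower ℝ (Cl E) S]

lemma act_volumeForm {m : ℕ} (e : OrthonormalBasis (Fin m) ℝ E) :
    act S (volumeForm e) = ((List.finRange m).map fun i => cmul S (e i)).prod := by
  rw [volumeForm, List.ofFn_eq_map, map_list_prod, List.map_map]
  rfl

/-- For `N = 8 k + 4`, evenness of `N` makes `ω` anticommute with vectors, and evenness of `N (N -
1) / 2` gives `ω² = 1`. -/
theorem isCliffordTriple_cmul (hdim : Module.finrank ℝ E % 8 = 4)
    (e : OrthonormalBasis (Fin (Module.finrank ℝ E)) ℝ E) (φ : ℍ[ℝ] ≃ₐ[ℝ] evenSchur E S) :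
    IsCliffordTriple (cmul S : E →ₗ[ℝ] _) (act S (volumeForm e)) (quat φ) := by
  have hanti := isAnticommuting_cmul (S := S) e
  obtain ⟨k, hk⟩ : ∃ k, Module.finrank ℝ E = 8 * k + 4 := ⟨Module.finrank ℝ E / 8, by omega⟩
  have hmem : ∀ h, quat φ h ∈ evenSchur E S := fun h => (φ h).2
  have hω : ∀ x : E, act S (volumeForm e) * cmul S x = -(cmul S x * act S (volumeForm e)) := by
    intro x
    rw [← e.sum_repr x, map_sum, Finset.sum_mul, Finset.mul_sum, ← Finset.sum_neg_distrib]
    refine Finset.sum_congr rfl fun i _ => ?_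
    have hev : Even (List.finRange (Module.finrank ℝ E)).length := by
      rw [List.length_finRange]
      exact ⟨4 * k + 2, by omega⟩
    have h := hanti.mul_prod_of_mem (List.nodup_finRange _) (List.mem_finRange i)
    rw [hev.neg_one_pow, one_mul, ← act_volumeForm] at h
    rw [map_smul, smul_mul_assoc, mul_smul_comm, h, smul_neg, neg_neg]
  refine ⟨fun x y => cmul_mul_cmul_add x y, hω, ?_, fun x h => mem_evenSchur.1 (hmem h) x,
    fun h => ?_, fun a b hab => φ.injective (Subtype.ext hab), fun A hA => ?_⟩
  · rw [act_volumeForm, hanti.prod_mul_prod (List.nodup_finRange _), List.length_finRange]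
    refine Even.neg_one_pow ?_
    rw [hk, Nat.choose_two_right]
    have : (8 * k + 4) * (8 * k + 4 - 1) = 2 * (2 * ((2 * k + 1) * (8 * k + 3))) := by
      rw [show 8 * k + 4 - 1 = 8 * k + 3 by omega]; ring
    rw [this, Nat.mul_div_cancel_left _ (by norm_num)]
    exact even_two_mul _
  · rw [act_volumeForm]
    refine (Commute.list_prod_left _ _ fun y hy => ?_).eq
    obtain ⟨i, -, rfl⟩ := List.mem_map.1 hy
    exact mem_evenSchur.1 (hmem h) _
  · exact ⟨φ.symm ⟨A, mem_evenSchur.2 hA⟩, by simp [quat]⟩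

lemma isDiagonalPair_rho (φ : ℍ[ℝ] ≃ₐ[ℝ] evenSchur E S) (ω : Module.End ℝ S) (ε : ℝ) (h₁ : ℍ[ℝ])
    (h₃ h₄ : E →ₗ[ℝ] ℍ[ℝ]) :
    IsDiagonalPair (cmul S) ω (quat φ) h₁ (ε • h₁) h₃ h₄ (rho₁₁ φ ω ε h₁ h₃ h₄)
      (rho₂₂ φ ω ε h₁ h₃ h₄) :=
  ⟨fun x => by simp [rho₁₁], fun x => by simp [rho₂₂]⟩

lemma IsDiagonalPair.eq_rho {φ : ℍ[ℝ] ≃ₐ[ℝ] evenSchur E S} {ω : Module.End ℝ S} {ε : ℝ}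
    {h₁ : ℍ[ℝ]} {h₃ h₄ : E →ₗ[ℝ] ℍ[ℝ]} {a d : E →ₗ[ℝ] Module.End ℝ S}
    (h : IsDiagonalPair (cmul S) ω (quat φ) h₁ (ε • h₁) h₃ h₄ a d) :
    a = rho₁₁ φ ω ε h₁ h₃ h₄ ∧ d = rho₂₂ φ ω ε h₁ h₃ h₄ :=
  ⟨LinearMap.ext fun x => (h.left x).trans ((isDiagonalPair_rho φ ω ε h₁ h₃ h₄).left x).symm,
    LinearMap.ext fun x => (h.right x).trans ((isDiagonalPair_rho φ ω ε h₁ h₃ h₄).right x).symm⟩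

lemma spinRep_wedge (v : E) : spinRep (E := E) S (wedge ((0, 1, 0) : E × ℝ × ℝ) (v, 0, 0)) =
    block 0 (√2 • cmul S v) 0 0 := by
  have hι : ∀ w, spinRep (E := E) S (CliffordAlgebra.ι (minkowskiForm E) w) = vecAct S w :=
    fun w => CliffordAlgebra.lift_ι_apply _ _ w
  have h1 : vecAct S ((0, 1, 0) : E × ℝ × ℝ) = block 0 ((2 * √2) • 1) 0 0 := by
    change block _ _ _ _ = _
    simp
  have h2 : vecAct S ((v, 0, 0) : E × ℝ × ℝ) = block (-cmul S v) 0 0 (cmul S v) := by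
    change block _ _ _ _ = _
    simp
  rw [wedge, map_smul, Ring.lie_def, map_sub, map_mul, map_mul, hι, hι, h1, h2, block_mul,
    block_mul, block_sub, smul_block]
  simp only [mul_zero, zero_mul, add_zero, zero_add, sub_zero, smul_zero, smul_mul_assoc, one_mul,
    mul_smul_comm, mul_one]
  congr 1
  module

end SpinModule


/-! ### Bracket relations in block form -/

section Representation

variable {E : Type*} [NormedAddCommGroup E] [InnerProductSpace ℝ E]
variable {S : Type*} [AddCommGroup S] [Module ℝ S] [Module (Cl E) S] [IsScalarTower ℝ (Cl E) S]

lemma exists_ne_zero_inner_eq_zero (hdim : 2 ≤ Module.finrank ℝ E) (y : E) :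
    ∃ z : E, z ≠ 0 ∧ inner ℝ z y = (0 : ℝ) := by
  by_contra! h
  have hker : LinearMap.ker (innerₗ E y) = ⊥ := by
    rw [LinearMap.ker_eq_bot']
    intro z hz
    by_contra h0
    refine h z h0 ?_
    rw [real_inner_comm]
    exact hz
  have h1 := LinearMap.finrank_le_finrank_of_injective (LinearMap.ker_eq_bot.1 hker)
  rw [Module.finrank_self] at h1
  omega

lemma cmul_mul_left_cancel {z : E} (hz : z ≠ 0) {A : Module.End ℝ S} (h : cmul S z * A = 0) :
    A = 0 := by
  have h1 : cmul S z * (cmul S z * A) = 0 := by rw [h, mul_zero]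
  rw [← mul_assoc, cmul_mul_self, smul_mul_assoc, one_mul] at h1
  exact (smul_eq_zero.1 h1).resolve_left (inner_self_ne_zero.2 hz)

variable [FiniteDimensional ℝ E]

lemma inner_endB (b : LinearMap.BilinForm ℝ E) (x y : E) :
    (inner ℝ (endB b x) y : ℝ) = b x y := by
  rw [endB_spec]
  simp [metric, innerₗ_apply_apply]

lemma endB_surjective {b : LinearMap.BilinForm ℝ E} (hb : b.Nondegenerate) :
    Function.Surjective (endB b) := by
  rw [← LinearMap.injective_iff_surjective, injective_iff_map_eq_zero]
  intro x hx
  refine hb.1 x fun y => ?_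
  rw [← inner_endB, hx, inner_zero_left]

namespace Heis

variable (b : LinearMap.BilinForm ℝ E)

lemma exists_eq_add (u : Heis b) :
    ∃ (x y : E) (s : ℝ), u = ofDual b (flat E x) + ofVec b y + s • p b := by
  obtain ⟨α, y, s⟩ := u
  refine ⟨(flat E).symm α, y, s, ?_⟩
  rw [LinearEquiv.apply_symm_apply]
  refine Prod.ext ?_ (Prod.ext ?_ ?_)
  · change α = α + 0 + s • (0 : Module.Dual ℝ E)
    simp
  · change y = 0 + y + s • (0 : E)
    simp
  · change s = 0 + 0 + s • (1 : ℝ)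
    simp

lemma lie_add_add (x y x' y' : E) (s s' : ℝ) :
    ⁅ofDual b (flat E x) + ofVec b y + s • p b, ofDual b (flat E x') + ofVec b y' + s' • p b⁆ =
      (b x y' - b x' y) • p b := by
  have h1 : ∀ z, dualPart b (ofDual b (flat E z)) = flat E z := fun z => rfl
  have h2 : ∀ z, vecPart b (ofDual b (flat E z)) = 0 := fun z => rfl
  have h3 : ∀ z, dualPart b (ofVec b z) = 0 := fun z => rfl
  have h4 : ∀ z, vecPart b (ofVec b z) = z := fun z => rfl
  simp only [bracket_def, map_add, map_smul, h1, h2, h3, h4, dualPart_p, vecPart_p, smul_zero,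
    add_zero, zero_add, LinearEquiv.symm_apply_apply]

lemma lie_vec_vec (x y : E) : ⁅ofVec b x, ofVec b y⁆ = 0 := by
  have h := lie_add_add b 0 x 0 y 0 0
  simpa using h

lemma lie_p (u : Heis b) : ⁅p b, u⁆ = 0 := by
  simp [bracket_def, dualPart_p, vecPart_p]

end Heis

/-- The block form of the spin representations of the Heisenberg algebra. -/
theorem isSpinRepresentation_iff (hdim : 2 ≤ Module.finrank ℝ E) {b : LinearMap.BilinForm ℝ E}
    (hb : b.Nondegenerate) (ρ : Heis b →ₗ[ℝ] Module.End ℝ (S × S)) :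
    IsSpinRepresentation b ρ ↔ ∃ (a d β : E →ₗ[ℝ] Module.End ℝ S) (Q : Module.End ℝ S),
      (∀ x, ρ (Heis.ofDual b (flat E x)) = block 0 (√2 • cmul S (endB b x)) 0 0) ∧
      ρ (Heis.p b) = √2 • block 0 Q 0 0 ∧
      (∀ x, ρ (Heis.ofVec b x) = block (a x) (β x) 0 (d x)) ∧
      IsSuitable a d β ∧
      (∀ z y, cmul S z * d y - a y * cmul S z = (inner ℝ z y : ℝ) • Q) ∧
      (∀ y, Q * d y = a y * Q) ∧
      (∀ x y, a x * a y = a y * a x) ∧ (∀ x y, d x * d y = d y * d x) := by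
  have hs : √2 ≠ 0 := by positivity
  constructor
  · rintro ⟨hlie, hspin⟩
    simp only [spinRep_wedge] at hspin
    obtain ⟨a, β, γ, d, hρ⟩ := exists_block (ρ ∘ₗ Heis.ofVec b)
    simp only [LinearMap.comp_apply] at hρ
    -- This is the bracket of `x^♭` and `y` with `z = B x`; nondegeneracy of `b` makes `z`
    -- arbitrary.
    have hkey : ∀ z y : E, (inner ℝ z y : ℝ) • ρ (Heis.p b) =
        √2 • block (cmul S z * γ y) (cmul S z * d y - a y * cmul S z) 0
          (-(γ y * cmul S z)) := by
      intro z y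
      obtain ⟨x, rfl⟩ := endB_surjective hb z
      rw [inner_endB, ← map_smul, ← Heis.flat_lie_vec, hlie, hspin, hρ, Ring.lie_def, block_mul,
        block_mul, block_sub, smul_block]
      simp [smul_sub]
    -- A nonzero `z` orthogonal to `y` makes the left side of `hkey` vanish, and Clifford
    -- multiplication by `z` is invertible.
    have hγ : ∀ y, γ y = 0 := fun y => by
      obtain ⟨z, hz, hzy⟩ := exists_ne_zero_inner_eq_zero hdim y
      have h := hkey z y
      rw [hzy, zero_smul, eq_comm, smul_eq_zero] at h
      have h := h.resolve_left hs
      rw [← block_zero, block_inj] at h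
      exact cmul_mul_left_cancel hz h.1
    simp only [hγ, mul_zero, zero_mul, neg_zero] at hkey
    have : Nontrivial E := Module.nontrivial_of_finrank_pos (R := ℝ) (by omega)
    obtain ⟨y₀, hy₀⟩ := exists_norm_eq E zero_le_one
    have hp : ρ (Heis.p b) = √2 • block 0 (cmul S y₀ * d y₀ - a y₀ * cmul S y₀) 0 0 := by
      rw [← hkey, real_inner_self_eq_norm_sq, hy₀]; simp
    set Q := cmul S y₀ * d y₀ - a y₀ * cmul S y₀
    have hvec : ∀ x, ρ (Heis.ofVec b x) = block (a x) (β x) 0 (d x) := fun x => by rw [hρ, hγ]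
    -- In the vanishing bracket of two vectors the diagonal entries give the commutation of the
    -- `a`'s and of the `d`'s, the corner entry gives suitability.
    have hcomm : ∀ x y, _ := fun x y => hlie (Heis.ofVec b x) (Heis.ofVec b y)
    simp only [Heis.lie_vec_vec, map_zero, hvec, Ring.lie_def, block_mul, block_sub,
      mul_zero, zero_mul, add_zero, zero_add, sub_zero, ← block_zero (S := S), block_inj,
      true_and] at hcomm
    refine ⟨a, d, β, Q, hspin, hp, hvec, fun x y => ?_, fun z y => ?_, fun y => ?_,
      fun x y => (sub_eq_zero.1 (hcomm x y).1.symm), fun x y => sub_eq_zero.1 (hcomm x y).2.2.symm⟩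
    · have h := (hcomm x y).2.1
      rw [← sub_eq_zero, h]
      abel
    · have h := hkey z y
      rw [hp, smul_comm] at h
      have h := smul_right_injective _ hs h
      rw [smul_block, block_inj] at h
      exact h.2.1.symm
    · have h := hlie (Heis.p b) (Heis.ofVec b y)
      rw [Heis.lie_p, map_zero, hp, hvec, Ring.lie_def, smul_block, block_mul, block_mul, block_sub,
        ← block_zero, block_inj] at h
      have h := h.2.1
      simp only [zero_mul, zero_add, mul_zero, smul_zero, add_zero, smul_mul_assoc,
        mul_smul_comm] at h
      exact smul_right_injective _ hs (sub_eq_zero.1 h.symm)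
  · rintro ⟨a, d, β, Q, hspin, hp, hvec, hsuit, hQ, hQc, ha, hd⟩
    refine ⟨fun u v => ?_, fun x => by rw [hspin, spinRep_wedge]⟩
    obtain ⟨x, y, s, rfl⟩ := Heis.exists_eq_add b u
    obtain ⟨x', y', s', rfl⟩ := Heis.exists_eq_add b v
    rw [Heis.lie_add_add, map_smul, ← inner_endB, ← inner_endB]
    simp only [map_add, map_smul, hspin, hvec, hp, smul_block, block_add, Ring.lie_def, block_mul,
      block_sub, smul_zero, add_zero, zero_add, mul_zero, zero_mul, block_inj, sub_self, true_and]
    refine ⟨(sub_eq_zero.2 (ha y y')).symm, ?_, (sub_eq_zero.2 (hd y y')).symm⟩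
    have e1 := hQ (endB b x) y'
    have e2 := hQ (endB b x') y
    have e3 := hsuit y y'
    have e4 := hQc y
    have e5 := hQc y'
    rw [smul_comm, sub_smul, ← e1, ← e2]
    rw [← sub_eq_zero] at e3 e4 e5
    rw [← sub_eq_zero]
    simp only [mul_add, add_mul, mul_smul_comm, smul_mul_assoc]
    calc _ = (s' * √2) • (Q * d y - a y * Q) - (s * √2) • (Q * d y' - a y' * Q) -
          (a y * β y' - β y' * d y - (a y' * β y - β y * d y')) := by module
      _ = 0 := by rw [e3, e4, e5]; simp

end Representation

end CahenWallach

/-! ### Spin representations of non-zero charge -/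

theorem theorem2p18 {E : Type*} [NormedAddCommGroup E] [InnerProductSpace ℝ E]
    [FiniteDimensional ℝ E] (hdim : Module.finrank ℝ E % 8 = 4)
    (e : OrthonormalBasis (Fin (Module.finrank ℝ E)) ℝ E)
    (b : LinearMap.BilinForm ℝ E) (hsymm : b.IsSymm) (hnondeg : b.Nondegenerate)
    {S : Type*} [AddCommGroup S] [Module ℝ S] [Module (CahenWallach.Cl E) S]
    [IsScalarTower ℝ (CahenWallach.Cl E) S] [IsSimpleModule (CahenWallach.Cl E) S] :
    Nonempty (ℍ[ℝ] ≃ₐ[ℝ] CahenWallach.evenSchur E S) ∧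
    ∀ φ : ℍ[ℝ] ≃ₐ[ℝ] CahenWallach.evenSchur E S,
    ∀ ω : Module.End ℝ S, ω = CahenWallach.act S (CahenWallach.volumeForm e) →
    ∀ ρ : CahenWallach.Heis b →ₗ[ℝ] Module.End ℝ (S × S),
      (CahenWallach.IsSpinRepresentation b ρ ∧ ρ (CahenWallach.Heis.p b) ≠ 0) ↔
      ∃ (ε : ℝ) (h₁ : ℍ[ℝ]) (h₃ h₄ : E →ₗ[ℝ] ℍ[ℝ]) (ρ₁₂ : E →ₗ[ℝ] Module.End ℝ S),
        (ε = 1 ∨ ε = -1) ∧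
        (CahenWallach.FirstCase ε h₁ h₃ h₄ ∨ CahenWallach.SecondCase h₁ h₃ h₄) ∧
        CahenWallach.IsSuitable (CahenWallach.rho₁₁ φ ω ε h₁ h₃ h₄)
          (CahenWallach.rho₂₂ φ ω ε h₁ h₃ h₄) ρ₁₂ ∧
        (∀ x : E, ρ (CahenWallach.Heis.ofDual b (CahenWallach.flat E x)) =
          CahenWallach.block 0
            (√2 • CahenWallach.cmul S (CahenWallach.endB b x)) 0 0) ∧
        ρ (CahenWallach.Heis.p b) =
          √2 • CahenWallach.block 0 (CahenWallach.quat φ h₁ * (1 + ε • ω)) 0 0 ∧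
        ∀ x : E, ρ (CahenWallach.Heis.ofVec b x) =
          CahenWallach.block (CahenWallach.rho₁₁ φ ω ε h₁ h₃ h₄ x) (ρ₁₂ x)
            0 (CahenWallach.rho₂₂ φ ω ε h₁ h₃ h₄ x) := by
  refine ⟨CahenWallach.nonempty_quaternion_algEquiv_evenSchur hdim, ?_⟩
  rintro φ ω rfl ρ
  have hs : √2 ≠ 0 := by positivity
  have h2 : 2 ≤ Module.finrank ℝ E := by omega
  have : Nontrivial E := Module.nontrivial_of_finrank_pos (R := ℝ) (by omega)
  obtain ⟨y₀, hy₀⟩ := exists_norm_eq E zero_le_one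
  have T := CahenWallach.isCliffordTriple_cmul hdim e φ
  rw [CahenWallach.isSpinRepresentation_iff h2 hnondeg]
  constructor
  · rintro ⟨⟨a, d, β, Q, hspin, hp, hvec, hsuit, hQ, hQc, ha, hd⟩, hp0⟩
    obtain ⟨ε, h₁, h₃, h₄, hε, hcase, rfl, hP⟩ := (T.classification hy₀ a d Q).1
      ⟨hQ, hQc, ha, hd, by
        rintro rfl
        exact hp0 (by rw [hp, CahenWallach.block_zero, smul_zero])⟩
    obtain ⟨rfl, rfl⟩ := hP.eq_rho
    exact ⟨ε, h₁, h₃, h₄, β, hε, hcase, hsuit, hspin, hp, hvec⟩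
  · rintro ⟨ε, h₁, h₃, h₄, β, hε, hcase, hsuit, hspin, hp, hvec⟩
    obtain ⟨hQ, hQc, ha, hd, hQ0⟩ := (T.classification hy₀ _ _ _).2
      ⟨ε, h₁, h₃, h₄, hε, hcase, rfl, CahenWallach.isDiagonalPair_rho _ _ _ _ _ _⟩
    refine ⟨⟨_, _, β, _, hspin, hp, hvec, hsuit, hQ, hQc, ha, hd⟩, fun h0 => hQ0 ?_⟩
    rw [hp, smul_eq_zero, ← CahenWallach.block_zero, CahenWallach.block_inj] at h0
    exact (h0.resolve_left hs).2.1
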